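/- A \emph{tiling} means an edge-to-edge tiling of the sphere by pentagons (a cellular decomposition of the sphere in which every tile is a pentagon with five distinct vertices) whose corners are labelled by symbols $\alpha,\beta,\gamma,\dots$, such that all tiles are corner congruent, i.e. they carry the same cyclic arrangement of labels up to rotation and reflection. Tilings are considered up to homeomorphisms of the sphere (possibly orientation reversing) that preserve the cell structure and the labels. A tiling is a tiling for $\mathrm{AVC}(3C24)=\{24\alpha^3\beta\gamma : 24\alpha^2\beta,\, 8\gamma^3,\, 6\alpha^4\}$ if it has $24$ tiles, each with the corners $\alpha,\alpha,\alpha,\beta,\gamma$, and its vertices are exactly $24$ vertices $\alpha^2\beta$, $8$ vertices $\gamma^3$ and $6$ vertices $\alpha^4$; similarly for $\mathrm{AVC}(3C60)=\{60\alpha^3\beta\gamma : 60\alpha^2\beta,\, 20\gamma^3,\, 12\alpha^5\}$. The pentagonal subdivisions $PP_8$ of the octahedron and $PP_{20}$ of the icosahedron are obtained as follows: divide each edge into three by two points, put a centre into each face, and join it to the first of the two dividing points of each edge of the face, in the counterclockwise order along the boundary of the face. Every tile has, in cyclic order, a centre, two dividing points of one edge, an old vertex, and a dividing point of the next edge; its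 corners there are labelled $\delta,\beta,\gamma,\epsilon,\alpha$, respectively. The $3C_1$ reduction replaces the labels $\alpha,\beta,\gamma,\delta,\epsilon$ by $\beta,\alpha,\alpha,\gamma,\alpha$, and the $3C_2$ reduction replaces them by $\alpha,\beta,\alpha,\gamma,\alpha$. For a vertex $\gamma^3$, $N(\gamma^3)$ is the union of the three tiles around it; to change its orientation is to reflect the labels of each of these three tiles, with the corner $\gamma$ fixed. \textbf{Theorem.} Suppose that $\beta$ and $\gamma$ are adjacent in the pentagon with the corners $\alpha,\alpha,\alpha,\beta,\gamma$. Then the tilings for $\mathrm{AVC}(3C24)$ (respectively $\mathrm{AVC}(3C60)$) with this pentagon are exactly the $3C_1$ and $3C_2$ reductions of $PP_8$ (respectively $PP_{20}$) and the modifications of these obtained by independently changing the orientations of any of the $N(\gamma^3)$. -/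

import Mathlib

/-- The symbols used to label the corners of pentagons. -/
inductive Angle : Type
  | α | β | γ | δ | ε
  deriving DecidableEq

/-- A cellular decomposition of an oriented closed surface, as a combinatorial map on the set `D`
of darts (directed edges). A dart `d` also stands for the corner, at the origin of `d`, of the tile
on the left of `d`. `edge d` is the same edge with the opposite direction, and `face d` is the next
dart in the counterclockwise boundary of the tile on the left of `d`. -/
structure OrientedMap (D : Type*) where
  edge : Equiv.Perm D
  face : Equiv.Perm D
  edge_edge : ∀ d, edge (edge d) = d
  edge_ne : ∀ d, edge d ≠ d

namespace OrientedMap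

variable {D : Type*} (M : OrientedMap D)

/-- The counterclockwise rotation of the darts around their common origin. -/
def rot : Equiv.Perm D := M.face.symm.trans M.edge

/-- Vertices, edges and tiles are the cycles of `rot`, `edge` and `face`. -/
abbrev Vertex : Type _ := Quotient (Equiv.Perm.SameCycle.setoid M.rot)
abbrev Edge : Type _ := Quotient (Equiv.Perm.SameCycle.setoid M.edge)
abbrev Face : Type _ := Quotient (Equiv.Perm.SameCycle.setoid M.face)

/-- The origin of a dart. -/
def vertexOf (d : D) : M.Vertex := Quotient.mk _ d

/-- The surface is connected. -/
def Connected : Prop :=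
  Nonempty D ∧ ∀ d d' : D, ∃ g ∈ Subgroup.closure {M.edge, M.face}, g d = d'

/-- The surface is the sphere: it is connected and `V - E + F = 2`. -/
def Spherical : Prop :=
  M.Connected ∧ Nat.card M.Vertex + Nat.card M.Face = Nat.card M.Edge + 2

/-- Every tile is a pentagon with five distinct vertices. -/
def Pentagonal : Prop :=
  (∀ d, (M.face ^ 5) d = d ∧ M.face d ≠ d) ∧
  ∀ d d', M.face.SameCycle d d' → M.vertexOf d = M.vertexOf d' → d = d'

/-- The combination (multiset) of the angles at a vertex. -/
noncomputable def anglesAt [Finite D] (label : D → Angle) (v : M.Vertex) : Multiset Angle :=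
  (Set.toFinite {d | M.vertexOf d = v}).toFinset.val.map label

end OrientedMap

/-- An anglewise vertex combination: the number of tiles, the angles of each tile, and the
angle combinations at the vertices, with their multiplicities. -/
structure AVC where
  numTiles : ℕ
  tile : Multiset Angle
  vertices : Multiset (Multiset Angle)

open Angle in
/-- `{24α³βγ : 24α²β, 8γ³, 6α⁴}` -/
def avc3C24 : AVC where
  numTiles := 24
  tile := {α, α, α, β, γ}
  vertices := Multiset.replicate 24 {α, α, β} + Multiset.replicate 8 {γ, γ, γ} +
    Multiset.replicate 6 {α, α, α, α}

open Angle in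
/-- `{60α³βγ : 60α²β, 20γ³, 12α⁵}` -/
def avc3C60 : AVC where
  numTiles := 60
  tile := {α, α, α, β, γ}
  vertices := Multiset.replicate 60 {α, α, β} + Multiset.replicate 20 {γ, γ, γ} +
    Multiset.replicate 12 {α, α, α, α, α}

/-- `x` and `y` are at adjacent corners of the pentagon whose corners are labelled, in cyclic
order, by `pent`. -/
def AdjacentIn (pent : Fin 5 → Angle) (x y : Angle) : Prop :=
  ∃ i, (pent i = x ∧ pent (i + 1) = y) ∨ (pent i = y ∧ pent (i + 1) = x)

/-- The map `M`, with its corners labelled by `label`, is a tiling of the sphere by pentagons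
that are all corner congruent to `pent` (rotations and reflections allowed), and its anglewise
vertex combination is `A`. -/
structure IsTilingFor {D : Type*} [Finite D] (M : OrientedMap D) (label : D → Angle)
    (pent : Fin 5 → Angle) (A : AVC) : Prop where
  spherical : M.Spherical
  pentagonal : M.Pentagonal
  congruent : ∀ d, ∃ i : Fin 5,
    (∀ k : Fin 5, label ((M.face ^ (k : ℕ)) d) = pent (i + k)) ∨
    (∀ k : Fin 5, label ((M.face ^ (k : ℕ)) d) = pent (i - k))
  numTiles : Nat.card M.Face = A.numTiles
  tile : Finset.univ.val.map pent = A.tile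
  vertices : ∀ c : Multiset Angle,
    Nat.card {v : M.Vertex // M.anglesAt label v = c} = A.vertices.count c

/-- Two labelled maps are the same tiling, i.e. there is a homeomorphism of the surfaces, which may
preserve or reverse the orientation, that matches vertices, edges, tiles and corner labels.
If it reverses the orientation, then `e d` is the image of the edge of `d` with the image of the
tile on the left of `d` on its left; its origin is the image of the end of `d`, that is, of the
origin of `face d`. -/
def SameTiling {D D' : Type*} (M : OrientedMap D) (label : D → Angle)
    (M' : OrientedMap D') (label' : D' → Angle) : Prop :=
  ∃ e : D ≃ D', (∀ d, e (M.edge d) = M'.edge (e d)) ∧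
    (((∀ d, e (M.face d) = M'.face (e d)) ∧ ∀ d, label' (e d) = label d) ∨
     ((∀ d, e (M.face d) = M'.face.symm (e d)) ∧ ∀ d, label' (e d) = label (M.face d)))

namespace OrientedMap

/-- The underlying function of `edge` in the pentagonal subdivision. -/
def subdivideEdge {D : Type*} (M : OrientedMap D) : D × Fin 5 → D × Fin 5
  | (d, 0) => (M.face.symm d, 4)
  | (d, 1) => (M.face (M.edge (M.face.symm d)), 1)
  | (d, 2) => (M.edge (M.face.symm d), 3)
  | (d, 3) => (M.face (M.edge d), 2)
  | (d, 4) => (M.face d, 0)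

theorem subdivideEdge_involutive {D : Type*} (M : OrientedMap D) :
    Function.Involutive M.subdivideEdge := by
  rintro ⟨d, k⟩
  fin_cases k <;> simp [subdivideEdge, M.edge_edge]

/-- The pentagonal subdivision. Every edge is divided into three by two points; every tile gets
a centre, which is joined to the first dividing point of each of its edges (in the
counterclockwise order). Write `m₁ d`, `m₂ d` for the first and second dividing point of `d`, so
`m₁ (edge d) = m₂ d`. The corner at the origin `u` of `d` of the tile on the left of `d`, with
centre `c`, becomes the pentagon with the vertices `c, m₁ d', m₂ d', u, m₁ d` in counterclockwise
order, where `d'` is the dart before `d`; `(d, k)` is the `k`-th dart of this pentagon. -/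
def subdivide {D : Type*} (M : OrientedMap D) : OrientedMap (D × Fin 5) where
  edge := M.subdivideEdge_involutive.toPerm
  face := Equiv.prodCongr (Equiv.refl D) (Equiv.addRight 1)
  edge_edge := M.subdivideEdge_involutive
  edge_ne := by
    rintro ⟨d, k⟩
    fin_cases k <;>
      simp [subdivideEdge, Function.Involutive.toPerm, Prod.ext_iff]
    intro h
    exact M.edge_ne (M.face.symm d) (M.face.injective (by simpa using h))

/-- The five angles in the pentagonal subdivision: `δ` at the centres, `ε` at the old vertices,
and `α`, `β`, `γ` at the dividing points. -/
def subdivideLabel {D : Type*} (x : D × Fin 5) : Angle :=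
  ![Angle.δ, Angle.β, Angle.γ, Angle.ε, Angle.α] x.2

/-- Counterclockwise darts of disjoint triangles indexed by `F`; `(f, k)` goes from the `k`-th to
the `(k+1)`-st vertex of the triangle `f`. -/
def triangleFace (F : Type*) : Equiv.Perm (F × Fin 3) :=
  Equiv.prodCongr (Equiv.refl F) (Equiv.addRight 1)

/-- The octahedron has the vertices `N`, `S` and `a i` (`i` modulo `4`), and the eight triangles
`(i, 0) = (N, a i, a (i+1))` and `(i, 1) = (S, a (i+1), a i)`. -/
def octahedronEdge : (Fin 4 × Fin 2) × Fin 3 → (Fin 4 × Fin 2) × Fin 3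
  | ((i, 0), 0) => ((i - 1, 0), 2)
  | ((i, 0), 1) => ((i, 1), 1)
  | ((i, 0), 2) => ((i + 1, 0), 0)
  | ((i, 1), 0) => ((i + 1, 1), 2)
  | ((i, 1), 1) => ((i, 0), 1)
  | ((i, 1), 2) => ((i - 1, 1), 0)

theorem octahedronEdge_involutive : Function.Involutive octahedronEdge := by
  unfold Function.Involutive
  decide

def octahedron : OrientedMap ((Fin 4 × Fin 2) × Fin 3) where
  edge := octahedronEdge_involutive.toPerm
  face := triangleFace _
  edge_edge := octahedronEdge_involutive
  edge_ne := by decide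

/-- The icosahedron has the vertices `N`, `S`, `a i` and `b i` (`i` modulo `5`), and the twenty
triangles `(i, 0) = (N, a i, a (i+1))`, `(i, 1) = (a i, b i, a (i+1))`,
`(i, 2) = (a (i+1), b i, b (i+1))` and `(i, 3) = (S, b (i+1), b i)`. -/
def icosahedronEdge : (Fin 5 × Fin 4) × Fin 3 → (Fin 5 × Fin 4) × Fin 3
  | ((i, 0), 0) => ((i - 1, 0), 2)
  | ((i, 0), 1) => ((i, 1), 2)
  | ((i, 0), 2) => ((i + 1, 0), 0)
  | ((i, 1), 0) => ((i - 1, 2), 2)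
  | ((i, 1), 1) => ((i, 2), 0)
  | ((i, 1), 2) => ((i, 0), 1)
  | ((i, 2), 0) => ((i, 1), 1)
  | ((i, 2), 1) => ((i, 3), 1)
  | ((i, 2), 2) => ((i + 1, 1), 0)
  | ((i, 3), 0) => ((i + 1, 3), 2)
  | ((i, 3), 1) => ((i, 2), 1)
  | ((i, 3), 2) => ((i - 1, 3), 0)

theorem icosahedronEdge_involutive : Function.Involutive icosahedronEdge := by
  unfold Function.Involutive
  decide

def icosahedron : OrientedMap ((Fin 5 × Fin 4) × Fin 3) where
  edge := icosahedronEdge_involutive.toPerm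
  face := triangleFace _
  edge_edge := icosahedronEdge_involutive
  edge_ne := by decide

/-- The pentagonal subdivisions of the octahedron and of the icosahedron. -/
def PP8 : OrientedMap (((Fin 4 × Fin 2) × Fin 3) × Fin 5) := octahedron.subdivide
def PP20 : OrientedMap (((Fin 5 × Fin 4) × Fin 3) × Fin 5) := icosahedron.subdivide

open Classical in
/-- Change the orientation of `N(γ³)`, the union of the three tiles around a vertex `γ³`, for all
the vertices `γ³` in the set `S`: the labels of each of the three tiles are reflected, with the
corner `γ` fixed. Here `k` is the number of steps from the corner `d` to the corner `γ` of its tile,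
so `2 * k` steps lead from `d` to its mirror image in the tile. (Every tile has exactly one `γ`.) -/
noncomputable def reorient {D : Type*} (M : OrientedMap D) (label : D → Angle)
    (S : Set M.Vertex) (d : D) : Angle :=
  let k := sInf {k : ℕ | label ((M.face ^ k) d) = Angle.γ}
  if M.vertexOf ((M.face ^ k) d) ∈ S then label ((M.face ^ (2 * k)) d) else label d

end OrientedMap

open Angle in
/-- The reduction `3C₁`: `α, β, γ, δ, ε → β, α, α, γ, α`. -/
def reduction3C1 : Angle → Angle
  | α => β
  | β => α
  | γ => α
  | δ => γ
  | ε => α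

open Angle in
/-- The reduction `3C₂`: `α, β, γ, δ, ε → α, β, α, γ, α`. -/
def reduction3C2 : Angle → Angle
  | α => α
  | β => β
  | γ => α
  | δ => γ
  | ε => α

/-- `M` with the labels `label` is the `3C₁` or the `3C₂` reduction of the pentagonal subdivision
`P` (with its angles given by `OrientedMap.subdivideLabel`), or is obtained from it by
independently changing the orientations of some of the `N(γ³)`. -/
def IsModifiedReduction {D E : Type*} (M : OrientedMap D) (label : D → Angle)
    (P : OrientedMap (E × Fin 5)) : Prop :=
  ∃ R : Angle → Angle, (R = reduction3C1 ∨ R = reduction3C2) ∧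
    ∃ S : Set P.Vertex,
      SameTiling M label P (P.reorient (R ∘ OrientedMap.subdivideLabel) S)

/-! Counted counterclockwise from γ, a tile reads γααα β or γβααα, so a labelled tile is recorded by
a sign, and a corner by a pair (tile, position). Positions 2 and 3 are α for both signs; the sign
only decides which of the positions 1 and 4 is β.

Consecutive tiles around a vertex γ³ share an edge, a spoke, at whose outer end position 4 of one
meets position 1 of the next. Two β cannot meet there, which forces equal signs around γ³; one β is
then present, so the outer end is α²β, and its third corner has position 2 or 3
(`exists_hasSpokes`). Each tile supplies exactly one such third corner. If some tile uses position
2, this spreads across edges, hence by connectedness to all tiles; otherwise all use position 3, and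
a reflection leads to the first case (`rot_four_two_or_three`, `exists_mirror`). All edge gluings
are now known: the tiling is the pentagonal subdivision of a map `B` with triangular faces, whose
darts are the tiles (`exists_eq_subdivide`). Position 3 is an old vertex and sees only α, so `B.rot
^ n = 1`, with `n` equal to 4 or 5.

The permutations `edge` and `face` of `B` satisfy the relations of the (2,3,n) triangle group, so
the octahedron or icosahedron covers `B`; the number of tiles makes the covering one-sheeted. What
remains free is one sign for each γ³, and flipping it is exactly a change of orientation of N(γ³)
(`reorient_signLabel`). Conversely, any signs constant around the γ³ give a tiling with the right
vertices, because positions 4, 2, 1 at a dividing point always show α²β (`isTilingFor_subdivide`).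
-/

open Function

/-! ### Counting cycles of a permutation -/

section Cycles

variable {D : Type*} [Finite D] (σ : Equiv.Perm D)

theorem minimalPeriod_perm_pos (d : D) : 0 < minimalPeriod σ d :=
  minimalPeriod_pos_of_mem_periodicPts (σ.injective.mem_periodicPts d)

theorem sameCycle_iff_exists_lt_minimalPeriod {d d' : D} :
    σ.SameCycle d d' ↔ ∃ k < minimalPeriod σ d, (σ ^ k) d = d' := by
  constructor
  · intro h
    obtain ⟨k, rfl⟩ := h.exists_nat_pow_eq
    refine ⟨k % minimalPeriod σ d, Nat.mod_lt _ (minimalPeriod_perm_pos σ d), ?_⟩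
    simp only [Equiv.Perm.coe_pow]
    exact iterate_mod_minimalPeriod_eq
  · rintro ⟨k, -, rfl⟩
    exact ⟨k, by simp⟩

theorem cycle_val_eq (d : D) :
    (Set.toFinite {d' | σ.SameCycle d d'}).toFinset.val =
      (Multiset.range (minimalPeriod σ d)).map fun k => (σ ^ k) d := by
  refine Multiset.Nodup.ext (Finset.nodup _) ?_ |>.2 fun d' => ?_
  · refine Multiset.Nodup.map_on (fun x hx y hy h => ?_) (Multiset.nodup_range _)
    rw [Multiset.mem_range] at hx hy
    simp only [Equiv.Perm.coe_pow] at h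
    exact (iterate_injOn_Iio_minimalPeriod (f := σ) (x := d)) hx hy h
  · simp [sameCycle_iff_exists_lt_minimalPeriod]

open Classical in
/-- The number of cycles with a given property. -/
theorem card_cycles_eq_sum [Fintype D] (p : Quotient (Equiv.Perm.SameCycle.setoid σ) → Prop) :
    (Nat.card {q // p q} : ℚ) =
      ∑ d : D, if p (Quotient.mk _ d) then (minimalPeriod σ d : ℚ)⁻¹ else 0 := by
  -- Group the darts by cycle: a cycle of length `m` contributes `m` terms `m⁻¹`, that is 1.
  rw [← Finset.sum_fiberwise (s := Finset.univ)
    (g := fun d => (Quotient.mk (Equiv.Perm.SameCycle.setoid σ) d))]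
  rw [Nat.card_eq_fintype_card, Fintype.card_subtype, ← Finset.sum_boole]
  refine Finset.sum_congr rfl fun q _ => ?_
  induction q using Quotient.inductionOn with | _ d => ?_
  have hf : (Finset.univ.filter fun x => (Quotient.mk (Equiv.Perm.SameCycle.setoid σ) x) =
      Quotient.mk _ d) = (Set.toFinite {d' | σ.SameCycle d d'}).toFinset := by
    ext x
    simp only [Finset.mem_filter, Finset.mem_univ, true_and, Set.Finite.mem_toFinset,
      Set.mem_ofPred_eq]
    rw [Quotient.eq]
    exact ⟨fun h => h.symm, fun h => h.symm⟩
  have hcard : ((Set.toFinite {d' | σ.SameCycle d d'}).toFinset.card : ℚ) =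
      minimalPeriod σ d := by
    rw [Finset.card_def, cycle_val_eq]
    simp
  have hp := minimalPeriod_perm_pos σ d
  rw [hf, Finset.sum_congr rfl (g := fun _ => if p (Quotient.mk _ d) then
    (minimalPeriod σ d : ℚ)⁻¹ else 0)]
  · rw [Finset.sum_const, nsmul_eq_mul, hcard]
    split_ifs
    · field_simp
    · simp
  · intro x hx
    rw [← hf, Finset.mem_filter] at hx
    rw [hx.2]
    congr 2
    have h : σ.SameCycle d x := (Quotient.exact hx.2).symm
    obtain ⟨k, rfl⟩ := h.exists_nat_pow_eq
    rw [Equiv.Perm.coe_pow]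
    exact congrArg _ <| minimalPeriod_apply_iterate (σ.injective.mem_periodicPts d) k

/-- The number of cycles when all the cycles have the same length. -/
theorem card_cycles_mul {m : ℕ} (h : ∀ d, minimalPeriod σ d = m) :
    Nat.card (Quotient (Equiv.Perm.SameCycle.setoid σ)) * m = Nat.card D := by
  classical
  have := Fintype.ofFinite D
  rcases isEmpty_or_nonempty D with hD | ⟨⟨d₀⟩⟩
  · have : IsEmpty (Quotient (Equiv.Perm.SameCycle.setoid σ)) :=
      ⟨fun q => Quotient.inductionOn q fun d => hD.elim d⟩
    simp
  have hm : 0 < m := h d₀ ▸ minimalPeriod_perm_pos σ d₀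
  have key := card_cycles_eq_sum σ (fun _ => True)
  simp only [if_true, h, Finset.sum_const, Finset.card_univ, nsmul_eq_mul] at key
  have e : Nat.card {q : Quotient (Equiv.Perm.SameCycle.setoid σ) // True} =
      Nat.card (Quotient (Equiv.Perm.SameCycle.setoid σ)) :=
    Nat.card_congr (Equiv.subtypeUnivEquiv fun _ => trivial)
  rw [e] at key
  rw [Nat.card_eq_fintype_card (α := D)]
  have hm' : (m : ℚ) ≠ 0 := by positivity
  field_simp at key
  exact_mod_cast key

end Cycles

theorem minimalPeriod_eq_two {D : Type*} {f : D → D} {d : D} (h : f (f d) = d) (h' : f d ≠ d) :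
    minimalPeriod f d = 2 :=
  have : Fact (Nat.Prime 2) := ⟨Nat.prime_two⟩
  minimalPeriod_eq_prime h h'

/-! ### Vertices and connectedness of combinatorial maps -/

namespace OrientedMap

variable {D : Type*}

theorem rot_apply (M : OrientedMap D) (d : D) : M.rot d = M.edge (M.face.symm d) := rfl

theorem vertexOf_eq_iff (M : OrientedMap D) {d d' : D} :
    M.vertexOf d = M.vertexOf d' ↔ M.rot.SameCycle d d' :=
  Quotient.eq (r := Equiv.Perm.SameCycle.setoid M.rot)

theorem vertexOf_surjective (M : OrientedMap D) : Function.Surjective M.vertexOf :=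
  Quotient.mk_surjective

theorem anglesAt_vertexOf [Finite D] (M : OrientedMap D) (label : D → Angle) (d : D) :
    M.anglesAt label (M.vertexOf d) =
      (Multiset.range (minimalPeriod M.rot d)).map fun k => label ((M.rot ^ k) d) := by
  have h : {d' | M.vertexOf d' = M.vertexOf d} = {d' | M.rot.SameCycle d d'} := by
    ext x
    simp only [Set.mem_ofPred_eq]
    rw [eq_comm, vertexOf_eq_iff]
  rw [anglesAt]
  simp only [h]
  rw [cycle_val_eq, Multiset.map_map]
  rfl

/-- A map is connected iff it has no invariant sets of darts but the trivial ones. -/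
theorem connected_iff (M : OrientedMap D) :
    M.Connected ↔ Nonempty D ∧ ∀ s : Set D, (∀ d, M.edge d ∈ s ↔ d ∈ s) →
      (∀ d, M.face d ∈ s ↔ d ∈ s) → s.Nonempty → ∀ d, d ∈ s := by
  refine and_congr_right fun _ => ⟨?_, ?_⟩
  · rintro h s he hf ⟨d₀, hd₀⟩ d
    obtain ⟨g, hg, rfl⟩ := h d₀ d
    have : ∀ d, g d ∈ s ↔ d ∈ s := by
      induction hg using Subgroup.closure_induction with
      | mem x hx =>
        rcases hx with rfl | rfl
        · exact he
        · exact hf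
      | one => simp
      | mul x y _ _ hx hy => intro d; rw [Equiv.Perm.mul_apply, hx, hy]
      | inv x _ hx => intro d; rw [← hx, ← Equiv.Perm.mul_apply, mul_inv_cancel, Equiv.Perm.one_apply]
    exact (this d₀).2 hd₀
  · intro h d d'
    have hmem : ∀ x ∈ ({M.edge, M.face} : Set (Equiv.Perm D)), ∀ c,
        (∃ g ∈ Subgroup.closure {M.edge, M.face}, g d = x c) ↔
          ∃ g ∈ Subgroup.closure {M.edge, M.face}, g d = c := by
      intro x hx c
      have hx := Subgroup.subset_closure hx
      constructor
      · rintro ⟨g, hg, h⟩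
        exact ⟨x⁻¹ * g, mul_mem (inv_mem hx) hg, by simp [h]⟩
      · rintro ⟨g, hg, h⟩
        exact ⟨x * g, mul_mem hx hg, by simp [h]⟩
    exact h {c | ∃ g ∈ Subgroup.closure {M.edge, M.face}, g d = c} (hmem _ (by simp))
      (hmem _ (by simp)) ⟨d, 1, one_mem _, rfl⟩ d'

end OrientedMap

/-! ### Tilings up to homeomorphism -/

namespace SameTiling

open OrientedMap

variable {D D' D'' : Type*} {M : OrientedMap D} {label : D → Angle}
  {M' : OrientedMap D'} {label' : D' → Angle} {M'' : OrientedMap D''} {label'' : D'' → Angle}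

theorem symm (h : SameTiling M label M' label') : SameTiling M' label' M label := by
  obtain ⟨e, he, h⟩ := h
  refine ⟨e.symm, fun d => by rw [Equiv.symm_apply_eq, he, e.apply_symm_apply], ?_⟩
  rcases h with ⟨hf, hl⟩ | ⟨hf, hl⟩
  · refine Or.inl ⟨fun d => by rw [Equiv.symm_apply_eq, hf, e.apply_symm_apply], fun d => ?_⟩
    rw [← hl, e.apply_symm_apply]
  · have hf' : ∀ d, e.symm (M'.face d) = M.face.symm (e.symm d) := fun d => by
      rw [Equiv.symm_apply_eq, ← Equiv.eq_symm_apply, ← hf, Equiv.apply_symm_apply,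
        Equiv.apply_symm_apply]
    refine Or.inr ⟨hf', fun d => ?_⟩
    have := hl (e.symm (M'.face d))
    rw [e.apply_symm_apply, hf', M.face.apply_symm_apply] at this
    exact this.symm

theorem trans (h : SameTiling M label M' label') (h' : SameTiling M' label' M'' label'') :
    SameTiling M label M'' label'' := by
  obtain ⟨e, he, h⟩ := h
  obtain ⟨e', he', h'⟩ := h'
  refine ⟨e.trans e', fun d => by simp [he, he'], ?_⟩
  rcases h with ⟨hf, hl⟩ | ⟨hf, hl⟩ <;> rcases h' with ⟨hf', hl'⟩ | ⟨hf', hl'⟩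
  · exact Or.inl ⟨fun d => by simp [hf, hf'], fun d => by simp [hl, hl']⟩
  · exact Or.inr ⟨fun d => by simp [hf, hf'], fun d => by simp [hl', ← hf, hl]⟩
  · refine Or.inr ⟨fun d => ?_, fun d => by simp [hl, hl']⟩
    simp only [Equiv.trans_apply, hf]
    rw [Equiv.eq_symm_apply, ← hf', Equiv.apply_symm_apply]
  · refine Or.inl ⟨fun d => ?_, fun d => ?_⟩
    · simp only [Equiv.trans_apply, hf]
      rw [← Equiv.symm_apply_eq, ← hf', Equiv.apply_symm_apply]
    · have := hf (M.face.symm d)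
      rw [Equiv.apply_symm_apply, Equiv.eq_symm_apply] at this
      rw [Equiv.trans_apply, hl', this, hl, Equiv.apply_symm_apply]

end SameTiling

theorem perm_pow_conj {D D' : Type*} {σ : Equiv.Perm D} {σ' : Equiv.Perm D'} {c : D → D'}
    (h : ∀ d, σ' (c d) = c (σ d)) (k : ℕ) (d : D) : (σ' ^ k) (c d) = c ((σ ^ k) d) := by
  induction k generalizing d with
  | zero => rfl
  | succ k ih => rw [pow_succ, pow_succ, Equiv.Perm.mul_apply, Equiv.Perm.mul_apply, h, ih]

theorem perm_zpow_conj {D D' : Type*} {σ : Equiv.Perm D} {σ' : Equiv.Perm D'} {c : D → D'}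
    (h : ∀ d, σ' (c d) = c (σ d)) (i : ℤ) (d : D) : (σ' ^ i) (c d) = c ((σ ^ i) d) := by
  cases i with
  | ofNat n => simpa using perm_pow_conj h n d
  | negSucc n =>
    rw [zpow_negSucc, zpow_negSucc, Equiv.Perm.inv_eq_iff_eq, perm_pow_conj h,
      ← Equiv.Perm.mul_apply, mul_inv_cancel, Equiv.Perm.one_apply]

theorem sameCycle_conj_iff {D D' : Type*} {σ : Equiv.Perm D} {σ' : Equiv.Perm D'} {c : D ≃ D'}
    (h : ∀ d, σ' (c d) = c (σ d)) (d d' : D) :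
    σ'.SameCycle (c d) (c d') ↔ σ.SameCycle d d' := by
  simp only [Equiv.Perm.SameCycle, perm_zpow_conj h, c.injective.eq_iff]

theorem sameCycle_apply_eq_of_invariant {D X : Type*} {σ : Equiv.Perm D} {u : D → X}
    (h : ∀ d, u (σ d) = u d) {d d' : D} (hd : σ.SameCycle d d') : u d = u d' := by
  obtain ⟨i, rfl⟩ := hd
  have := perm_zpow_conj (σ := σ) (σ' := 1) (c := u) (fun d => (h d).symm) i d
  simpa using this

theorem perm_pow_val_add {D : Type*} {σ : Equiv.Perm D} {m : ℕ} [NeZero m] (h : σ ^ m = 1)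
    (i j : Fin m) : σ ^ ((i + j : Fin m) : ℕ) = σ ^ (i : ℕ) * σ ^ (j : ℕ) := by
  rw [← pow_add, Fin.val_add, ← pow_eq_pow_mod _ h]

theorem perm_symm_pow_val {D : Type*} {σ : Equiv.Perm D} {m : ℕ} [NeZero m] (h : σ ^ m = 1)
    (i : Fin m) : σ.symm ^ (i : ℕ) = σ ^ ((-i : Fin m) : ℕ) := by
  have : σ ^ ((-i : Fin m) : ℕ) * σ ^ (i : ℕ) = 1 := by
    rw [← perm_pow_val_add h]; simp
  rw [eq_inv_of_mul_eq_one_left this, ← inv_pow]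
  rfl

namespace OrientedMap

variable {D : Type*}

theorem Pentagonal.pow_five {M : OrientedMap D} (h : M.Pentagonal) : M.face ^ 5 = 1 :=
  Equiv.ext fun d => (h.1 d).1

theorem card_edge [Finite D] (M : OrientedMap D) : Nat.card M.Edge * 2 = Nat.card D :=
  card_cycles_mul M.edge fun d => minimalPeriod_eq_two (M.edge_edge d) (M.edge_ne d)

theorem Pentagonal.card_face [Finite D] {M : OrientedMap D} (h : M.Pentagonal) :
    Nat.card M.Face * 5 = Nat.card D :=
  card_cycles_mul M.face fun d =>
    have : Fact (Nat.Prime 5) := ⟨Nat.prime_five⟩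
    minimalPeriod_eq_prime (by
      have := (h.1 d).1
      rwa [Equiv.Perm.coe_pow] at this) (h.1 d).2

end OrientedMap

namespace SameTiling

open OrientedMap

variable {D D' : Type*} {M : OrientedMap D} {label : D → Angle}
  {M' : OrientedMap D'} {label' : D' → Angle}

/-- The correspondence of the corners of two descriptions of the same tiling. -/
theorem exists_corner_equiv (h : SameTiling M label M' label') :
    ∃ c : D ≃ D', (∀ d, label' (c d) = label d) ∧
      (∀ d d', M'.rot.SameCycle (c d) (c d') ↔ M.rot.SameCycle d d') ∧
      ((∀ d, M'.face (c d) = c (M.face d)) ∨ ∀ d, M'.face (c d) = c (M.face.symm d)) := by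
  obtain ⟨e, he, ⟨hf, hl⟩ | ⟨hf, hl⟩⟩ := h
  · refine ⟨e, hl, sameCycle_conj_iff fun d => ?_, Or.inl fun d => (hf d).symm⟩
    rw [rot_apply, rot_apply, he]
    congr 1
    rw [Equiv.symm_apply_eq, ← hf, Equiv.apply_symm_apply]
  · have hs : ∀ d, M'.face (e d) = e (M.face.symm d) := fun d => by
      have := hf (M.face.symm d)
      rw [Equiv.apply_symm_apply, Equiv.eq_symm_apply] at this
      exact this
    -- An orientation-reversing `e` gives `e d` the label of `face d`, so corners are carried by `e`
    -- after `face⁻¹`; this map conjugates `rot` to its inverse.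
    refine ⟨M.face.symm.trans e, fun d => by simp [hl], fun d d' => ?_, Or.inr fun d => by simp [hs]⟩
    rw [← Equiv.Perm.sameCycle_inv (f := M.rot)]
    refine sameCycle_conj_iff (fun d => ?_) d d'
    have h1 : M.rot⁻¹ d = M.face (M.edge d) := by
      rw [Equiv.Perm.inv_eq_iff_eq, rot_apply, Equiv.symm_apply_apply, M.edge_edge]
    rw [h1, rot_apply]
    simp only [Equiv.trans_apply, Equiv.symm_apply_apply, he]
    rw [← hf, Equiv.apply_symm_apply]

theorem isTilingFor [Finite D] [Finite D'] (h : SameTiling M label M' label')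
    {pent : Fin 5 → Angle} {A : AVC} (hM : IsTilingFor M label pent A) :
    IsTilingFor M' label' pent A := by
  obtain ⟨c, hl, hr, hf⟩ := exists_corner_equiv h
  have hcard : Nat.card D = Nat.card D' := Nat.card_congr c
  have hfc : ∀ d d', M'.face.SameCycle (c d) (c d') ↔ M.face.SameCycle d d' := by
    rcases hf with hf | hf
    · exact sameCycle_conj_iff hf
    · intro d d'
      rw [← Equiv.Perm.sameCycle_inv (f := M.face)]
      exact sameCycle_conj_iff hf d d'
  have hv : ∀ d d', M'.vertexOf (c d) = M'.vertexOf (c d') ↔ M.vertexOf d = M.vertexOf d' :=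
    fun d d' => by rw [vertexOf_eq_iff, vertexOf_eq_iff, hr]
  have h5 := hM.pentagonal.pow_five
  have hpow : (∀ (k : Fin 5) d, (M'.face ^ (k : ℕ)) (c d) = c ((M.face ^ (k : ℕ)) d)) ∨
      ∀ (k : Fin 5) d, (M'.face ^ (k : ℕ)) (c d) = c ((M.face ^ ((-k : Fin 5) : ℕ)) d) := by
    rcases hf with hf | hf
    · exact Or.inl fun k => perm_pow_conj hf k
    · exact Or.inr fun k d => by rw [perm_pow_conj hf, perm_symm_pow_val h5]
  let ev : M.Vertex ≃ M'.Vertex := Quotient.congr c fun d d' => (hr d d').symm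
  let ef : M.Face ≃ M'.Face := Quotient.congr c fun d d' => (hfc d d').symm
  have hev : ∀ d, ev (M.vertexOf d) = M'.vertexOf (c d) := fun _ => rfl
  have hang : ∀ v, M'.anglesAt label' (ev v) = M.anglesAt label v := by
    intro v
    obtain ⟨d, rfl⟩ := M.vertexOf_surjective v
    rw [hev, anglesAt, anglesAt]
    have : (Set.toFinite {d' | M'.vertexOf d' = M'.vertexOf (c d)}).toFinset =
        (Set.toFinite {d' | M.vertexOf d' = M.vertexOf d}).toFinset.map c.toEmbedding := by
      ext x
      obtain ⟨x, rfl⟩ := c.surjective x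
      simp [hv]
    rw [this, Finset.map_val, Multiset.map_map]
    exact Multiset.map_congr rfl fun x _ => hl x
  have hcon : M'.Connected := by
    obtain ⟨e, he, h⟩ := h
    obtain ⟨⟨d₀⟩, hs⟩ := (connected_iff M).1 hM.spherical.1
    refine (connected_iff M').2 ⟨⟨e d₀⟩, fun s h1 h2 ⟨d', hd'⟩ d => ?_⟩
    obtain ⟨d, rfl⟩ := e.surjective d
    refine hs (e ⁻¹' s) (fun d => ?_) (fun d => ?_) ⟨e.symm d', by simpa using hd'⟩ d
    · simp only [Set.mem_preimage, he, h1]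
    · simp only [Set.mem_preimage]
      rcases h with ⟨hf, -⟩ | ⟨hf, -⟩
      · rw [hf, h2]
      · rw [hf, ← h2, Equiv.apply_symm_apply]
  refine ⟨⟨hcon, ?_⟩, ⟨fun d => ?_, fun d d' => ?_⟩, fun d => ?_, ?_, hM.tile, fun a => ?_⟩
  -- Edges are half of the darts, so they need no bijection of their own.
  · rw [← Nat.card_congr ev, ← Nat.card_congr ef, hM.spherical.2]
    have h1 := card_edge M
    have h2 := card_edge M'
    omega
  · obtain ⟨d, rfl⟩ := c.surjective d
    constructor
    · rcases hf with hf | hf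
      · rw [perm_pow_conj hf, (hM.pentagonal.1 d).1]
      · rw [perm_pow_conj hf]
        change c ((M.face⁻¹ ^ 5) d) = c d
        rw [inv_pow, h5]
        rfl
    · rcases hf with hf | hf
      · rw [hf, c.injective.ne_iff]
        exact (hM.pentagonal.1 d).2
      · rw [hf, c.injective.ne_iff, ne_eq, Equiv.symm_apply_eq, eq_comm]
        exact (hM.pentagonal.1 d).2
  · obtain ⟨d, rfl⟩ := c.surjective d
    obtain ⟨d', rfl⟩ := c.surjective d'
    rw [hfc, hv, c.injective.eq_iff]
    exact hM.pentagonal.2 d d'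
  · obtain ⟨d, rfl⟩ := c.surjective d
    obtain ⟨i, hi⟩ := hM.congruent d
    refine ⟨i, ?_⟩
    rcases hpow with hp | hp
    · simpa only [hp, hl] using hi
    · simp only [hp, hl]
      rcases hi with hi | hi
      · exact Or.inr fun k => by rw [hi, sub_eq_add_neg]
      · exact Or.inl fun k => by rw [hi, sub_neg_eq_add]
  · rw [← Nat.card_congr ef, hM.numTiles]
  · rw [← hM.vertices a]
    exact (Nat.card_congr (ev.subtypeEquiv fun v => by rw [hang])).symm

end SameTiling

/-! ### Tiles as signs, corners as positions relative to γ -/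

open Angle in
/-- The corners of a tile, counterclockwise from `γ`; the sign `b` tells whether `β` comes last or
first after `γ`. -/
def cornerLabel (b : Bool) (k : Fin 5) : Angle :=
  if b then ![γ, α, α, α, β] k else ![γ, β, α, α, α] k

/-- Reflecting a tile with γ fixed amounts to flipping its sign. -/
theorem cornerLabel_neg (b : Bool) (k : Fin 5) : cornerLabel b (-k) = cornerLabel (!b) k := by
  revert b k; decide

theorem cornerLabel_eq_γ_iff {b : Bool} {k : Fin 5} : cornerLabel b k = Angle.γ ↔ k = 0 := by
  revert b k; decide

/-- A pentagon with the angles `α, α, α, β, γ` with `β` and `γ` adjacent. -/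
theorem exists_eq_cornerLabel {pent : Fin 5 → Angle}
    (hpent : Finset.univ.val.map pent = {Angle.α, Angle.α, Angle.α, Angle.β, Angle.γ})
    (hadj : AdjacentIn pent Angle.β Angle.γ) :
    ∃ (j : Fin 5) (b : Bool), ∀ k, pent k = cornerLabel b (k - j) := by
  have huniq : ∀ x, Multiset.count x ({Angle.α, Angle.α, Angle.α, Angle.β, Angle.γ} :
      Multiset Angle) = 1 → ∀ i j, pent i = x → pent j = x → i = j := by
    intro x hx i j hi hj
    rw [← hpent, Multiset.count_map] at hx
    by_contra hij
    have h2 : ({i, j} : Finset (Fin 5)).val ≤ Finset.univ.val.filter fun a => x = pent a := by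
      rw [← Finset.filter_val, Finset.val_le_iff]
      intro a ha
      simp only [Finset.mem_insert, Finset.mem_singleton] at ha
      rcases ha with rfl | rfl <;> simp [hi, hj]
    have := Multiset.card_le_card h2
    rw [hx, ← Finset.card_def, Finset.card_pair hij] at this
    omega
  have hβ := huniq Angle.β (by decide)
  have hγ := huniq Angle.γ (by decide)
  have hmem : ∀ i, pent i = Angle.α ∨ pent i = Angle.β ∨ pent i = Angle.γ := by
    intro i
    have : pent i ∈ Finset.univ.val.map pent := Multiset.mem_map_of_mem _ (by simp)
    rw [hpent] at this
    simpa using this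
  have key : ∀ i j b, pent i = Angle.β → pent j = Angle.γ → i = j + (if b then 4 else 1) →
      ∀ k, pent k = cornerLabel b (k - j) := by
    intro i j b hi hj hij k
    have hk : pent k = Angle.α ∨ k = i ∨ k = j := by
      rcases hmem k with h | h | h
      · exact Or.inl h
      · exact Or.inr (Or.inl (hβ _ _ h hi))
      · exact Or.inr (Or.inr (hγ _ _ h hj))
    rcases hk with h | rfl | rfl
    · have h1 : k ≠ i := by rintro rfl; rw [hi] at h; cases h
      have h2 : k ≠ j := by rintro rfl; rw [hj] at h; cases h
      rw [h]
      subst hij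
      revert h1 h2
      clear * -
      revert b k j
      decide
    · rw [hi, hij, add_sub_cancel_left]
      cases b <;> rfl
    · rw [hj, sub_self]
      cases b <;> rfl
  obtain ⟨i, ⟨h1, h2⟩ | ⟨h1, h2⟩⟩ := hadj
  · exact ⟨i + 1, true, key i (i + 1) true h1 h2 (by clear h1 h2; revert i; decide)⟩
  · exact ⟨i, false, key (i + 1) i false h2 h1 rfl⟩

/-- A rotation moves the position of γ and a reflection also flips the sign, so the choice of `pent`
no longer matters. -/
theorem congruent_iff {pent : Fin 5 → Angle} {j : Fin 5} {b : Bool}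
    (h : ∀ k, pent k = cornerLabel b (k - j)) (f : Fin 5 → Angle) :
    (∃ i, (∀ k, f k = pent (i + k)) ∨ ∀ k, f k = pent (i - k)) ↔
      ∃ (j' : Fin 5) (b' : Bool), ∀ k, f k = cornerLabel b' (k - j') := by
  simp only [h]
  constructor
  · rintro ⟨i, hi | hi⟩
    · exact ⟨j - i, b, fun k => by rw [hi]; congr 1; abel⟩
    · exact ⟨i - j, !b, fun k => by rw [hi, ← cornerLabel_neg]; congr 1; abel⟩
  · rintro ⟨j', b', hb⟩
    by_cases hbb : b' = b
    · subst hbb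
      exact ⟨j - j', Or.inl fun k => by rw [hb]; congr 1; abel⟩
    · have : b' = !b := by cases b <;> cases b' <;> simp_all
      subst this
      exact ⟨j + j', Or.inr fun k => by rw [hb, ← cornerLabel_neg]; congr 1; abel⟩

namespace OrientedMap

/-- The tiles of the map are indexed by `G`, and `(g, k)` is the `k`-th dart of the tile `g`. -/
def HasTiles {G : Type*} (M : OrientedMap (G × Fin 5)) : Prop :=
  ∀ g k, M.face (g, k) = (g, k + 1)

end OrientedMap

open OrientedMap

/-- The labels of the corners in terms of the signs of the tiles. -/
def signLabel {G : Type*} (s : G → Bool) (x : G × Fin 5) : Angle := cornerLabel (s x.1) x.2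

/-- Index the corners of a tiling by the tiles and the position relative to `γ`. -/
theorem IsTilingFor.exists_tiles {D : Type*} [Finite D] {M : OrientedMap D} {label : D → Angle}
    {pent : Fin 5 → Angle} {A : AVC} (hM : IsTilingFor M label pent A) {j : Fin 5} {b : Bool}
    (hp : ∀ k, pent k = cornerLabel b (k - j)) :
    ∃ (M' : OrientedMap ({d // label d = Angle.γ} × Fin 5))
      (s : {d // label d = Angle.γ} → Bool), M'.HasTiles ∧
        SameTiling M label M' (signLabel s) := by
  have h5 := hM.pentagonal.pow_five
  have hcong : ∀ d, ∃ (j' : Fin 5) (b' : Bool), ∀ k : Fin 5,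
      label ((M.face ^ (k : ℕ)) d) = cornerLabel b' (k - j') := fun d =>
    (congruent_iff hp fun k : Fin 5 => label ((M.face ^ (k : ℕ)) d)).1 (hM.congruent d)
  have hsign : ∀ g : {d // label d = Angle.γ}, ∃ b' : Bool, ∀ k : Fin 5,
      label ((M.face ^ (k : ℕ)) g) = cornerLabel b' k := by
    rintro ⟨g, hg⟩
    obtain ⟨j', b', h⟩ := hcong g
    have h0 := h 0
    rw [Fin.val_zero, pow_zero, Equiv.Perm.one_apply, hg, eq_comm, cornerLabel_eq_γ_iff, zero_sub,
      neg_eq_zero] at h0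
    subst h0
    exact ⟨b', by simpa using h⟩
  choose s hs using hsign
  let E₀ : {d // label d = Angle.γ} × Fin 5 → D := fun x => (M.face ^ (x.2 : ℕ)) x.1
  -- Injectivity is the uniqueness of γ in a tile, surjectivity its existence.
  have hE₀ : Bijective E₀ := by
    constructor
    · rintro ⟨g, k⟩ ⟨g', k'⟩ h
      have h' : (g : D) = (M.face ^ ((-k + k' : Fin 5) : ℕ)) g' := by
        have hk : M.face ^ ((-k : Fin 5) : ℕ) * M.face ^ (k : ℕ) = 1 := by
          rw [← perm_pow_val_add h5, neg_add_cancel, Fin.val_zero, pow_zero]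
        have := congrArg (M.face ^ ((-k : Fin 5) : ℕ)) h
        simp only [E₀] at this
        rw [← Equiv.Perm.mul_apply, ← Equiv.Perm.mul_apply, hk, ← perm_pow_val_add h5] at this
        exact this
      have h0 := hs g' (-k + k')
      rw [← h', g.2, eq_comm, cornerLabel_eq_γ_iff, neg_add_eq_zero] at h0
      subst h0
      simp only [neg_add_cancel, Fin.val_zero, pow_zero, Equiv.Perm.one_apply] at h'
      rw [Subtype.ext h']
    · intro d
      obtain ⟨j', b', h⟩ := hcong d
      refine ⟨(⟨(M.face ^ (j' : ℕ)) d, by rw [h, cornerLabel_eq_γ_iff, sub_self]⟩, -j'), ?_⟩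
      simp only [E₀]
      rw [← Equiv.Perm.mul_apply, ← perm_pow_val_add h5, neg_add_cancel]
      rfl
  let E := Equiv.ofBijective E₀ hE₀
  have hE : ∀ g k, M.face (E (g, k)) = E (g, k + 1) := fun g k => by
    change M.face ((M.face ^ (k : ℕ)) g) = (M.face ^ ((k + 1 : Fin 5) : ℕ)) g
    rw [add_comm, perm_pow_val_add h5]
    rfl
  refine ⟨⟨(E.trans M.edge).trans E.symm, (E.trans M.face).trans E.symm, fun d => ?_, fun d => ?_⟩,
    s, fun g k => ?_, E.symm, fun d => ?_, Or.inl ⟨fun d => ?_, fun d => ?_⟩⟩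
  · simp [M.edge_edge]
  · simp only [Equiv.trans_apply, ne_eq, Equiv.symm_apply_eq]
    exact M.edge_ne _
  · simp [hE]
  · simp
  · simp
  · obtain ⟨⟨g, k⟩, rfl⟩ := E.surjective d
    rw [E.symm_apply_apply]
    exact (hs g k).symm

/-! ### Degrees and labels at the three kinds of vertices -/

namespace OrientedMap

/-- The angles at the vertices are `α²β`, `γ³` and `αⁿ`. -/
def VertexCondition {D : Type*} [Finite D] (M : OrientedMap D) (label : D → Angle) (n : ℕ) : Prop :=
  ∀ v, M.anglesAt label v = {Angle.α, Angle.α, Angle.β} ∨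
    M.anglesAt label v = {Angle.γ, Angle.γ, Angle.γ} ∨
    M.anglesAt label v = Multiset.replicate n Angle.α

variable {D : Type*} [Finite D] {M : OrientedMap D} {label : D → Angle} {n : ℕ}

theorem rot_pow_of_card_anglesAt {d : D} (h : Multiset.card (M.anglesAt label (M.vertexOf d)) = n) :
    (M.rot ^ n) d = d := by
  rw [anglesAt_vertexOf, Multiset.card_map, Multiset.card_range] at h
  rw [← h, Equiv.Perm.coe_pow]
  exact iterate_minimalPeriod

theorem label_mem_anglesAt (M : OrientedMap D) (label : D → Angle) (d : D) (k : ℕ) :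
    label ((M.rot ^ k) d) ∈ M.anglesAt label (M.vertexOf d) := by
  have : M.vertexOf d = M.vertexOf ((M.rot ^ k) d) :=
    M.vertexOf_eq_iff.2 ⟨k, by simp⟩
  rw [this, anglesAt_vertexOf]
  exact Multiset.mem_map.2 ⟨0, by simpa using minimalPeriod_perm_pos _ _, rfl⟩

theorem anglesAt_eq_of_card_eq_three {d : D}
    (h : Multiset.card (M.anglesAt label (M.vertexOf d)) = 3) :
    M.anglesAt label (M.vertexOf d) = {label d, label (M.rot d), label (M.rot (M.rot d))} := by
  rw [anglesAt_vertexOf, Multiset.card_map, Multiset.card_range] at h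
  rw [anglesAt_vertexOf, h]
  rfl

namespace VertexCondition

variable (hV : M.VertexCondition label n)

include hV

theorem γ_vertex {d : D} (hd : label d = Angle.γ) :
    (M.rot ^ 3) d = d ∧ label (M.rot d) = Angle.γ := by
  have h0 := label_mem_anglesAt M label d 0
  have h1 := label_mem_anglesAt M label d 1
  simp only [pow_zero, Equiv.Perm.one_apply, hd, pow_one] at h0 h1
  rcases hV (M.vertexOf d) with h | h | h
  · rw [h] at h0; simp at h0
  · exact ⟨rot_pow_of_card_anglesAt (by rw [h]; rfl), by rw [h] at h1; simpa using h1⟩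
  · rw [h] at h0; have := Multiset.eq_of_mem_replicate h0; cases this

theorem β_vertex {d : D} (hd : label d = Angle.β) : (M.rot ^ 3) d = d ∧
    label (M.rot d) = Angle.α ∧ label (M.rot (M.rot d)) = Angle.α := by
  have h0 := label_mem_anglesAt M label d 0
  simp only [pow_zero, Equiv.Perm.one_apply, hd] at h0
  rcases hV (M.vertexOf d) with h | h | h
  · have h3 : Multiset.card (M.anglesAt label (M.vertexOf d)) = 3 := by rw [h]; rfl
    refine ⟨rot_pow_of_card_anglesAt h3, ?_⟩
    have h4 := anglesAt_eq_of_card_eq_three h3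
    rw [h, hd, show ({Angle.α, Angle.α, Angle.β} : Multiset Angle) =
      Angle.β ::ₘ {Angle.α, Angle.α} by decide] at h4
    have h5 : ({Angle.α, Angle.α} : Multiset Angle) =
      {label (M.rot d), label (M.rot (M.rot d))} := (Multiset.cons_inj_right _).1 h4
    have h6 : ∀ x ∈ ({label (M.rot d), label (M.rot (M.rot d))} : Multiset Angle), x = Angle.α := by
      rw [← h5]; simp
    exact ⟨h6 _ (by simp), h6 _ (by simp)⟩
  · rw [h] at h0; simp at h0
  · rw [h] at h0; have := Multiset.eq_of_mem_replicate h0; cases this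

theorem α_vertex {d : D} (hd : ∀ k, label ((M.rot ^ k) d) = Angle.α) : (M.rot ^ n) d = d := by
  have key : ∀ x ∈ M.anglesAt label (M.vertexOf d), x = Angle.α := by
    rw [anglesAt_vertexOf]
    intro x hx
    obtain ⟨k, -, rfl⟩ := Multiset.mem_map.1 hx
    exact hd k
  rcases hV (M.vertexOf d) with h | h | h
  · have := key Angle.β (by rw [h]; simp); cases this
  · have := key Angle.γ (by rw [h]; simp); cases this
  · exact rot_pow_of_card_anglesAt (by rw [h]; simp)

end VertexCondition

end OrientedMap

theorem fin_five_cases (k : Fin 5) : k = 0 ∨ k = 1 ∨ k = 2 ∨ k = 3 ∨ k = 4 := by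
  revert k; decide

/-! ### From the spokes at the vertices γ³ to a pentagonal subdivision -/

namespace OrientedMap

theorem ext_perm {D : Type*} {M N : OrientedMap D} (he : M.edge = N.edge)
    (hf : M.face = N.face) : M = N := by
  cases M; cases N; cases he; cases hf; rfl

variable {G : Type*} {M : OrientedMap (G × Fin 5)}

theorem HasTiles.rot_apply (hT : M.HasTiles) (g : G) (k : Fin 5) :
    M.rot (g, k + 1) = M.edge (g, k) := by
  rw [OrientedMap.rot_apply, ← hT, Equiv.symm_apply_apply]

/-- The tile `ρ g` follows `g` around its vertex `γ³`; the end of their common edge has the degree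
three, and the third corner there is at the position `2` or `3` of its tile. -/
structure HasSpokes (M : OrientedMap (G × Fin 5)) (ρ : Equiv.Perm G) : Prop where
  tiles : M.HasTiles
  pow_three : ∀ g, ρ (ρ (ρ g)) = g
  rot_zero : ∀ g, M.rot (g, 0) = (ρ g, 0)
  rot_one : ∀ g, M.rot (ρ g, 1) = (g, 4)
  rot_rot_four : ∀ g, M.rot (M.rot (g, 4)) = (ρ g, 1)
  rot_four : ∀ g, ∃ h, M.rot (g, 4) = (h, 2) ∨ M.rot (g, 4) = (h, 3)

/-- γ occurs only in γ³, so rotation permutes the corners at position 0; this permutation is `ρ`.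
Everything else is read off at the outer ends of the spokes, where one of the positions 1 and 4 is
β. -/
theorem exists_hasSpokes [Finite G] {s : G → Bool} {n : ℕ} (hT : M.HasTiles)
    (hV : M.VertexCondition (signLabel s) n) :
    ∃ ρ, M.HasSpokes ρ ∧ ∀ g, s (ρ g) = s g := by
  have h0 : ∀ g, (M.rot (g, 0)).2 = 0 := fun g => by
    have := (hV.γ_vertex (d := (g, 0)) (cornerLabel_eq_γ_iff.2 rfl)).2
    exact cornerLabel_eq_γ_iff.1 this
  have hρ₀ : ∀ g, M.rot (g, 0) = ((M.rot (g, 0)).1, 0) := fun g => Prod.ext rfl (h0 g)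
  have hinj : Injective fun g => (M.rot (g, 0)).1 := fun g g' h => by
    have : M.rot (g, 0) = M.rot (g', 0) := Prod.ext h ((h0 g).trans (h0 g').symm)
    simpa using this
  let ρ : Equiv.Perm G := Equiv.ofBijective _ (Finite.injective_iff_bijective.1 hinj)
  have hρ : ∀ g, M.rot (g, 0) = (ρ g, 0) := hρ₀
  have h3 : ∀ g, ρ (ρ (ρ g)) = g := fun g => by
    have h := (hV.γ_vertex (d := (g, 0)) (cornerLabel_eq_γ_iff.2 rfl)).1
    simp only [pow_succ, pow_zero, one_mul, Equiv.Perm.mul_apply, hρ] at h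
    exact congrArg Prod.fst h
  have h1 : ∀ g, M.rot (ρ g, 1) = (g, 4) := fun g => by
    have e1 : M.edge (g, 4) = (ρ g, 0) := by rw [← hT.rot_apply, ← hρ]; rfl
    have e2 : M.rot (ρ g, 1) = M.edge (ρ g, 0) := by rw [← hT.rot_apply]; rfl
    rw [e2, ← e1, M.edge_edge]
  -- Otherwise `(ρ g, 1)` and `(g, 4)` would be two β at one vertex. Going three times around γ³
  -- gives the converse.
  have hstep : ∀ g, s (ρ g) = false → s g = false := fun g h => by
    have := (hV.β_vertex (d := (ρ g, 1)) (by simp [signLabel, h, cornerLabel])).2.1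
    rw [h1] at this
    by_contra hg
    rw [Bool.not_eq_false] at hg
    simp [signLabel, hg, cornerLabel] at this
  have hs : ∀ g, s (ρ g) = s g := fun g => by
    by_cases hg : s g = false
    · have := hstep (ρ g) (hstep (ρ (ρ g)) (by rw [h3, hg]))
      rw [hg, this]
    · have : ¬ s (ρ g) = false := fun h => hg (hstep g h)
      rw [Bool.not_eq_false] at hg this
      rw [hg, this]
  have h4 : ∀ g, M.rot (M.rot (g, 4)) = (ρ g, 1) ∧ signLabel s (M.rot (g, 4)) = Angle.α := by
    intro g
    by_cases hg : s g = false
    · obtain ⟨ha, -, hc⟩ := hV.β_vertex (d := (ρ g, 1)) (by simp [signLabel, hs, hg, cornerLabel])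
      simp only [pow_succ, pow_zero, one_mul, Equiv.Perm.mul_apply, h1] at ha hc
      exact ⟨ha, hc⟩
    · obtain ⟨ha, hc, -⟩ := hV.β_vertex (d := (g, 4)) (by
        rw [Bool.not_eq_false] at hg
        simp [signLabel, hg, cornerLabel])
      refine ⟨?_, hc⟩
      apply M.rot.injective
      rw [h1]
      simpa only [pow_succ, pow_zero, one_mul, Equiv.Perm.mul_apply] using ha
  refine ⟨ρ, ⟨hT, h3, hρ, h1, fun g => (h4 g).1, fun g => ?_⟩, hs⟩
  obtain ⟨hr, hl⟩ := h4 g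
  rcases hz : M.rot (g, 4) with ⟨h, k⟩
  rw [hz] at hr hl
  refine ⟨h, ?_⟩
  -- Rotation takes position 0 to 0 and position 1 to 4, but the third corner to position 1;
  -- position 4 is reached only from position 1.
  have hcases := fin_five_cases k
  rcases hcases with rfl | rfl | rfl | rfl | rfl
  · rw [hρ] at hr; simp at hr
  · obtain ⟨h, rfl⟩ := ρ.surjective h
    rw [h1] at hr; simp at hr
  · exact Or.inl rfl
  · exact Or.inr rfl
  · rw [← h1 h] at hz
    simpa using M.rot.injective hz

/-- Orbits are finite, so going forward from `σ g` eventually returns to `g`. -/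
theorem mem_iff_of_perm {G : Type*} [Finite G] {σ : Equiv.Perm G} {P : G → Prop}
    (h : ∀ g, P g → P (σ g)) (g : G) : P (σ g) ↔ P g := by
  refine ⟨fun hg => ?_, h g⟩
  have hk : ∀ k : ℕ, P ((σ ^ k) (σ g)) := by
    intro k
    induction k with
    | zero => exact hg
    | succ k ih => rw [pow_succ', Equiv.Perm.mul_apply]; exact h _ ih
  have hc : σ.SameCycle (σ g) g := ⟨-1, by simp⟩
  obtain ⟨k, hkg⟩ := hc.exists_nat_pow_eq
  exact hkg ▸ hk k

namespace HasSpokes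

variable {ρ : Equiv.Perm G} (hM : M.HasSpokes ρ)

include hM

theorem edge_zero (g : G) : M.edge (ρ g, 0) = (g, 4) := by
  rw [← hM.rot_one, ← hM.tiles.rot_apply]; rfl

theorem edge_four (g : G) : M.edge (g, 4) = (ρ g, 0) := by
  rw [← hM.edge_zero, M.edge_edge]

theorem edge_three (g : G) : M.edge (g, 3) = M.rot (g, 4) := (hM.tiles.rot_apply g 3).symm

theorem edge_one_of_rot_four {g h : G} (hg : M.rot (g, 4) = (h, 2)) :
    M.edge (h, 1) = (ρ g, 1) := by
  rw [← hM.rot_rot_four, hg, ← hM.tiles.rot_apply]; rfl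

theorem edge_two_of_rot_four {g h : G} (hg : M.rot (g, 4) = (h, 2)) :
    M.edge (h, 2) = (g, 3) := by
  rw [← hg, ← hM.edge_three, M.edge_edge]

theorem rot_three_of_rot_four {g h : G} (hg : M.rot (g, 4) = (h, 2)) :
    M.rot (h, 3) = (g, 3) := by
  rw [← hM.edge_two_of_rot_four hg, ← hM.tiles.rot_apply]; rfl

/-- The first incidence makes `(g, 3)` follow `(h, 3)`, the second would make a corner at position 1
follow it. -/
theorem not_both {g g' h : G} (hg : M.rot (g, 4) = (h, 2)) : M.rot (g', 4) ≠ (h, 3) := by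
  intro hg'
  have h1 := hM.rot_rot_four g'
  rw [hg', hM.rot_three_of_rot_four hg] at h1
  simp at h1

/-- Every tile has exactly one of the corners `2` and `3` at the end of an edge from a vertex `γ³`,
and if there is one with `2` then all of them are so. -/
theorem rot_four_two_or_three [Finite G] (hc : M.Connected) :
    (∀ h, ∃ g, M.rot (g, 4) = (h, 2)) ∨ ∀ h, ∃ g, M.rot (g, 4) = (h, 3) := by
  choose p₀ hp₀ using hM.rot_four
  -- By `not_both` a tile is the third one at no more than one spoke; by finiteness, at exactly one.
  have hinj : Injective p₀ := by
    intro g g' h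
    have hg := hp₀ g
    have hg' := hp₀ g'
    rw [← h] at hg'
    have : M.rot (g, 4) = M.rot (g', 4) := by
      rcases hg with hg | hg <;> rcases hg' with hg' | hg'
      · rw [hg, hg']
      · exact absurd hg' (hM.not_both hg)
      · exact absurd hg (hM.not_both hg')
      · rw [hg, hg']
    simpa using this
  obtain ⟨p, hp⟩ : ∃ p : Equiv.Perm G, ∀ g, p g = p₀ g :=
    ⟨Equiv.ofBijective p₀ (Finite.injective_iff_bijective.1 hinj), fun _ => rfl⟩
  simp only [← hp] at hp₀
  let P : G → Prop := fun h => ∃ g, M.rot (g, 4) = (h, 2)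
  by_cases hP : ∃ h, P h
  · left
    have hPp : ∀ {g}, P (p g) → M.rot (g, 4) = (p g, 2) := fun {g} ⟨g', hg'⟩ =>
      (hp₀ g).resolve_right (hM.not_both hg')
    have h1 : ∀ g, P (p g) → P (ρ g) := by
      intro g hg
      have e1 := hM.edge_one_of_rot_four (hPp hg)
      have e2 : M.rot (ρ g, 2) = (p g, 1) := by
        rw [show (2 : Fin 5) = 1 + 1 from rfl, hM.tiles.rot_apply, ← e1, M.edge_edge]
      obtain ⟨k, hk⟩ := ρ.surjective (p g)
      rw [← hk, ← hM.rot_rot_four] at e2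
      exact ⟨k, (M.rot.injective e2).symm⟩
    have h2 : ∀ g, P (p g) → P g := by
      intro g hg
      have e1 := hM.rot_three_of_rot_four (hPp hg)
      obtain ⟨k, rfl⟩ := p.surjective g
      refine ⟨k, (hp₀ k).resolve_right fun h => ?_⟩
      rw [← h] at e1
      simpa using M.rot.injective e1
    have h2' : ∀ g, P (p g) ↔ P g := by
      have := mem_iff_of_perm (σ := p) (P := fun g => ¬ P g) fun g hg hg' => hg (h2 g hg')
      exact fun g => not_iff_not.1 (this g)
    have h1' : ∀ g, P (ρ g) ↔ P g := mem_iff_of_perm fun g hg => h1 g ((h2' g).2 hg)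
    -- Across its edges a tile meets only images of itself under `ρ`, `p` and their inverses and
    -- composites, which all preserve `P`.
    have hedge : ∀ x : G × Fin 5, P x.1 → P (M.edge x).1 := by
      rintro ⟨h, k⟩ hh
      obtain ⟨g, hg⟩ := id hh
      have hgp : p g = h := by
        rcases hp₀ g with h' | h' <;> · rw [hg] at h'; simp at h'; try exact h'.symm
      have hg' : P g := by rw [← h2', hgp]; exact hh
      have hcases := fin_five_cases k
      rcases hcases with rfl | rfl | rfl | rfl | rfl
      · obtain ⟨h, rfl⟩ := ρ.surjective h
        rw [hM.edge_zero]
        exact (h1' h).1 hh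
      · rw [hM.edge_one_of_rot_four hg]
        exact (h1' g).2 hg'
      · rwa [hM.edge_two_of_rot_four hg]
      · rw [hM.edge_three, hPp ((h2' h).2 hh)]
        exact (h2' h).2 hh
      · rw [hM.edge_four]
        exact (h1' h).2 hh
    obtain ⟨h₀, hh₀⟩ := hP
    have hall := ((connected_iff M).1 hc).2 {x | P x.1} (fun x => ⟨fun hx => by
      have := hedge _ hx
      rwa [M.edge_edge] at this, hedge x⟩) (fun ⟨g, k⟩ => by rw [hM.tiles]; rfl) ⟨(h₀, 0), hh₀⟩
    exact fun h => hall (h, 0)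
  · right
    intro h
    obtain ⟨g, rfl⟩ := p.surjective h
    exact ⟨g, (hp₀ g).resolve_left fun h => hP ⟨_, g, h⟩⟩

/-- Then the map is a pentagonal subdivision. -/
theorem exists_eq_subdivide (h : ∀ h, ∃ g, M.rot (g, 4) = (h, 2)) :
    ∃ B : OrientedMap G, M = B.subdivide ∧ B.face = ρ := by
  choose q₀ hq₀ using h
  have hq : Bijective q₀ := by
    constructor
    · intro g g' h
      have := hq₀ g
      rw [h, hq₀ g'] at this
      simpa using this.symm
    · intro g
      obtain ⟨h, hg | hg⟩ := hM.rot_four g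
      · refine ⟨h, ?_⟩
        have := hq₀ h
        rw [← hg] at this
        simpa using this
      · exact absurd hg (hM.not_both (hq₀ h))
  obtain ⟨q, hqq⟩ : ∃ q : Equiv.Perm G, ∀ g, q g = q₀ g := ⟨Equiv.ofBijective q₀ hq, fun _ => rfl⟩
  simp only [← hqq] at hq₀
  have e1 : ∀ h, M.edge (h, 1) = (ρ (q h), 1) := fun h => hM.edge_one_of_rot_four (hq₀ h)
  have e2 : ∀ h, M.edge (h, 2) = (q h, 3) := fun h => hM.edge_two_of_rot_four (hq₀ h)
  have hinv : ∀ h, ρ (q (ρ (q h))) = h := fun h => by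
    have := M.edge_edge (h, 1)
    rw [e1, e1] at this
    exact congrArg Prod.fst this
  have e3 : ∀ h, M.edge (h, 3) = (ρ (q (ρ h)), 2) := fun h => by
    obtain ⟨h, rfl⟩ := q.surjective h
    rw [← e2, M.edge_edge, hinv]
  -- In a subdivision dart 2 of `d` is glued to dart 3 of `edge (face⁻¹ d)`; compared with `e2`,
  -- this forces `edge` to be `q` after `ρ`.
  refine ⟨⟨ρ.trans q, ρ, fun d => ?_, fun d => ?_⟩, ?_, rfl⟩
  · simp only [Equiv.trans_apply]
    exact ρ.injective (hinv (ρ d))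
  · intro h
    have h' : ρ (q (ρ d)) = ρ d := congrArg ρ h
    refine M.edge_ne (ρ d, 1) ?_
    rw [e1, h']
  · refine OrientedMap.ext_perm ?_ ?_
    · ext1 ⟨g, k⟩
      have hcases := fin_five_cases k
      obtain ⟨g, rfl⟩ := ρ.surjective g
      rcases hcases with rfl | rfl | rfl | rfl | rfl
      · refine (hM.edge_zero g).trans ?_
        simp [subdivide, subdivideEdge]
      · refine (e1 _).trans ?_
        simp [subdivide, subdivideEdge]
      · refine (e2 _).trans ?_
        simp [subdivide, subdivideEdge]
      · refine (e3 _).trans ?_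
        simp [subdivide, subdivideEdge]
      · refine (hM.edge_four _).trans ?_
        simp [subdivide, subdivideEdge]
    · ext1 ⟨g, k⟩
      exact hM.tiles g k

end HasSpokes

/-- The reflection of a map with its tiles indexed: the position `k` becomes `-k`. -/
theorem exists_mirror (hT : M.HasTiles) (s : G → Bool) :
    ∃ M' : OrientedMap (G × Fin 5), M'.HasTiles ∧
      SameTiling M (signLabel s) M' (signLabel fun g => !s g) ∧
      ∀ g k h l, M.rot (g, k) = (h, l) → M'.rot (h, -l) = (g, -k) := by
  -- Dart `k` joins the corners `k` and `k + 1`; its mirror image starts at the corner `-(k + 1)`.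
  let e : G × Fin 5 ≃ G × Fin 5 := Equiv.prodCongr (Equiv.refl G) (Equiv.subLeft (-1))
  have he : ∀ g k, e (g, k) = (g, -1 - k) := fun _ _ => rfl
  have hes : ∀ g k, e.symm (g, k) = (g, -1 - k) := fun g k => by
    rw [Equiv.symm_apply_eq, he, sub_sub_cancel]
  let M' : OrientedMap (G × Fin 5) :=
    { edge := (e.symm.trans M.edge).trans e
      face := Equiv.prodCongr (Equiv.refl G) (Equiv.addRight 1)
      edge_edge := fun d => by simp [M.edge_edge]
      edge_ne := fun d => by
        simp only [Equiv.trans_apply, ne_eq, ← Equiv.eq_symm_apply e]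
        exact M.edge_ne _ }
  have hT' : M'.HasTiles := fun _ _ => rfl
  refine ⟨M', hT', ⟨e, fun d => ?_, Or.inr ⟨?_, ?_⟩⟩, ?_⟩
  · simp [M']
  · rintro ⟨g, k⟩
    rw [Equiv.eq_symm_apply, hT, he, hT', he]
    congr 1
    abel
  · rintro ⟨g, k⟩
    rw [hT, he, signLabel, signLabel, ← cornerLabel_neg]
    have : ∀ k : Fin 5, k + 1 = -(-1 - k) := by decide
    exact congrArg (cornerLabel (s g)) (this k).symm
  · intro g k h l hr
    have h1 : M.edge (g, k - 1) = (h, l) := by rw [← hr, ← hT.rot_apply, sub_add_cancel]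
    have h2 : M.edge (h, l) = (g, k - 1) := by rw [← h1, M.edge_edge]
    rw [show -l = (-1 - l) + 1 by abel, hT'.rot_apply]
    change e (M.edge (e.symm (h, -1 - l))) = _
    rw [hes, sub_sub_cancel, h2, he]
    congr 1
    abel

/-- Up to reflection, a tiling with its vertices `α²β`, `γ³` and `αⁿ` is a subdivision. -/
theorem exists_sameTiling_subdivide [Finite G] {s : G → Bool} {n : ℕ} (hT : M.HasTiles)
    (hV : ∀ (M' : OrientedMap (G × Fin 5)) (s' : G → Bool),
      SameTiling M (signLabel s) M' (signLabel s') → M'.VertexCondition (signLabel s') n)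
    (hc : M.Connected) :
    ∃ (B : OrientedMap G) (s' : G → Bool), SameTiling M (signLabel s) B.subdivide (signLabel s') ∧
      (∀ g, s' (B.face g) = s' g) ∧ B.face ^ 3 = 1 ∧ B.rot ^ n = 1 := by
  have hrefl : SameTiling M (signLabel s) M (signLabel s) :=
    ⟨Equiv.refl _, fun _ => rfl, Or.inl ⟨fun _ => rfl, fun _ => rfl⟩⟩
  obtain ⟨ρ, hρ, hs⟩ := exists_hasSpokes hT (hV M s hrefl)
  suffices ∃ (B : OrientedMap G) (s' : G → Bool),
      SameTiling M (signLabel s) B.subdivide (signLabel s') ∧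
      (∀ g, s' (B.face g) = s' g) ∧ B.face ^ 3 = 1 by
    obtain ⟨B, s', h1, h2, h3⟩ := this
    refine ⟨B, s', h1, h2, h3, Equiv.ext fun g => ?_⟩
    have hr : ∀ g, B.subdivide.rot (g, 3) = (B.rot g, 3) := fun g => rfl
    have hr' : ∀ (k : ℕ) g, (B.subdivide.rot ^ k) (g, 3) = ((B.rot ^ k) g, 3) := fun k g =>
      perm_pow_conj (c := fun g => (g, (3 : Fin 5))) hr k g
    -- Position 3 is α for both signs and is preserved by rotation, so the vertex is αⁿ.
    have := (hV _ _ h1).α_vertex (d := (g, 3)) fun k => by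
      rw [hr']
      simp only [signLabel, cornerLabel]
      split_ifs <;> rfl
    rw [hr'] at this
    exact congrArg Prod.fst this
  rcases hρ.rot_four_two_or_three hc with h | h
  · obtain ⟨B, rfl, hB⟩ := hρ.exists_eq_subdivide h
    exact ⟨B, s, hrefl, by rwa [hB], by rw [hB]; exact Equiv.ext hρ.pow_three⟩
  · obtain ⟨M', hT', hsame, hrot⟩ := exists_mirror hT s
    obtain ⟨ρ', hρ', hs'⟩ := exists_hasSpokes hT' (hV M' _ hsame)
    obtain ⟨B, rfl, hB⟩ := hρ'.exists_eq_subdivide fun h' => by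
      obtain ⟨g, hg⟩ := h h'
      refine ⟨ρ g, ?_⟩
      -- Here `(h, 3)` is followed by `(ρ g, 1)`. The reflection negates positions and reverses
      -- rotation, so position 4 of `ρ g` is followed by position 2 of `h`.
      have h1 := hρ.rot_rot_four g
      rw [hg] at h1
      exact hrot _ _ _ _ h1
    exact ⟨B, _, hsame, by rwa [hB], by rw [hB]; exact Equiv.ext hρ'.pow_three⟩

end OrientedMap

/-! ### Relations in the triangle groups (2,3,4) and (2,3,5) -/

section Relations

variable {H : Type*} [Group H] {e f : H}

theorem mul_eq_of_rot_pow_four (he : e * e = 1) (hf : f * f * f = 1) (hr : (e * f⁻¹) ^ 4 = 1) :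
    e * (f * f * (e * f)) = f * (e * f) * (e * f⁻¹) := by
  have he' : e⁻¹ = e := inv_eq_of_mul_eq_one_left he
  have hf' : f * f = f⁻¹ := eq_inv_of_mul_eq_one_left hf
  rw [← mul_inv_eq_one, ← hr]
  simp only [mul_inv_rev, inv_inv, he', hf', pow_succ, pow_zero, one_mul, mul_assoc]
  rw [← mul_assoc f f, hf']

theorem mul_eq_of_rot_pow_five (he : e * e = 1) (hf : f * f * f = 1) (hr : (e * f⁻¹) ^ 5 = 1) :
    e * (f * (e * f)) * (e * f⁻¹) = f * f * (e * (f * f * (e * f))) := by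
  have he' : e⁻¹ = e := inv_eq_of_mul_eq_one_left he
  have hf' : f * f = f⁻¹ := eq_inv_of_mul_eq_one_left hf
  have hff : f⁻¹ * f⁻¹ = f := by rw [← mul_inv_rev, hf', inv_inv]
  have hfe : (e * f) ^ 5 = 1 := by
    have h1 : (e * f) = e * (e * f⁻¹)⁻¹ * e⁻¹ := by
      rw [mul_inv_rev, inv_inv, he']; simp only [mul_assoc, he, mul_one]
    rw [h1, conj_pow, inv_pow, hr]; simp
  rw [← mul_inv_eq_one, ← hfe]
  simp only [mul_inv_rev, inv_inv, he', hf', pow_succ, pow_zero, one_mul, mul_assoc]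
  rw [← mul_assoc f⁻¹ f⁻¹, hff]

/-- The quotient of the two sides contains half of the relator; replacing it by the inverse of the
other half (`hmid`) and cancelling leaves the relator itself. -/
theorem mul_eq_of_rot_pow_five' (he : e * e = 1) (hf : f * f * f = 1) (hr : (e * f⁻¹) ^ 5 = 1) :
    e * (f * f * (e * (f * (e * (f * f * (e * f)))))) =
      f * (e * (f * (e * (f * f * (e * f))))) * (e * f⁻¹) := by
  have he' : e⁻¹ = e := inv_eq_of_mul_eq_one_left he
  have hf' : f * f = f⁻¹ := eq_inv_of_mul_eq_one_left hf
  have hmid : f⁻¹ * (e * (f⁻¹ * (e * f⁻¹))) = e * (f * (e * (f * e))) := by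
    rw [← mul_inv_eq_one, ← mul_right_inj e, mul_one]
    have : (e * f⁻¹) ^ 5 * e = e := by rw [hr, one_mul]
    refine Eq.trans ?_ this
    simp only [mul_inv_rev, he', pow_succ, pow_zero, one_mul, mul_assoc]
  rw [← mul_inv_eq_one]
  simp only [mul_inv_rev, inv_inv, he', hf', mul_assoc]
  rw [← mul_assoc f f, hf']
  have hee : ∀ x, e * (e * x) = x := fun x => by rw [← mul_assoc, he, one_mul]
  have hff : ∀ x, f * (f * x) = f⁻¹ * x := fun x => by rw [← mul_assoc, hf']
  have hmid' : ∀ x, f⁻¹ * (e * (f⁻¹ * (e * (f⁻¹ * x)))) = e * (f * (e * (f * (e * x)))) :=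
    fun x => by simpa only [mul_assoc] using congrArg (· * x) hmid
  rw [hmid' (e * (f * (e * (f⁻¹ * (e * f⁻¹)))))]
  simp only [hee, hff]
  rw [← hr]
  simp only [pow_succ, pow_zero, one_mul, mul_assoc]

end Relations

/-! ### Coverings by the octahedron and the icosahedron -/

namespace OrientedMap

variable {G E : Type*}

/-- A covering of `B` by `C`, given by a map of the darts. -/
def IsCovering (C : OrientedMap E) (B : OrientedMap G) (φ : E → G) : Prop :=
  (∀ d, φ (C.edge d) = B.edge (φ d)) ∧ ∀ d, φ (C.face d) = B.face (φ d)

theorem edge_mul_edge (B : OrientedMap G) : B.edge * B.edge = 1 := Equiv.ext B.edge_edge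

theorem rot_eq_mul (B : OrientedMap G) : B.rot = B.edge * B.face⁻¹ := rfl

/-- A dart goes to the image of the base dart `x` under the word of a path leading to it. The
hypotheses say that the words do not depend on the path. -/
theorem exists_isCovering_of_words {C : OrientedMap E} {B : OrientedMap G}
    {w : E → Equiv.Perm G} (he : ∀ d, w (C.edge d) = B.edge * w d)
    (hf : ∀ d, w (C.face d) = B.face * w d) (x : G) : ∃ φ, IsCovering C B φ :=
  ⟨fun d => w d x, fun d => by simp [he], fun d => by simp [hf]⟩

theorem exists_octahedron_covering (B : OrientedMap G) (hf : B.face ^ 3 = 1) (hr : B.rot ^ 4 = 1)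
    (x : G) : ∃ φ, IsCovering octahedron B φ := by
  have he := B.edge_mul_edge
  rw [rot_eq_mul] at hr
  generalize hfe : B.face = f at *
  generalize hee : B.edge = e at *
  have hf' : f * f * f = 1 := by rw [← hf]; simp [pow_succ]
  have hff : ∀ y, f * (f * (f * y)) = y := fun y => by simp only [← mul_assoc, hf', one_mul]
  have hee' : ∀ y, e * (e * y) = y := fun y => by simp only [← mul_assoc, he, one_mul]
  have hinv : f⁻¹ = f * f := inv_eq_of_mul_eq_one_left hf'
  have h2 : ∀ y, e * (f * (f * (e * (f * y)))) = f * (e * (f * (e * (f * (f * y))))) := fun y => by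
    simpa only [mul_assoc, hinv] using congrArg (· * y) (mul_eq_of_rot_pow_four he hf' hr)
  have hr1 : ∀ i : Fin 4, (e * f⁻¹) ^ ((1 + i : Fin 4) : ℕ) = e * (f * (f * (e * f⁻¹) ^ (i : ℕ))) :=
    fun i => by rw [perm_pow_val_add hr, hinv]; simp [mul_assoc]
  have hp1 : ∀ k : Fin 3, f ^ ((k + 1 : Fin 3) : ℕ) = f * f ^ (k : ℕ) := fun k => by
    rw [add_comm, perm_pow_val_add hf]; rfl
  have h00 : f ^ ((0 : Fin 3) : ℕ) = 1 := rfl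
  have h11 : f ^ ((1 : Fin 3) : ℕ) = f := pow_one f
  have h22 : f ^ ((2 : Fin 3) : ℕ) = f * f := pow_two f
  -- Rotate `i` times about `N`, cross the edge to the lower triangle if needed, then turn within
  -- the triangle. Crossing there is built in; the gluings around `S` need `h2`.
  let w : (Fin 4 × Fin 2) × Fin 3 → Equiv.Perm G := fun d => f ^ (d.2 : ℕ) *
    ![(e * f⁻¹) ^ (d.1.1 : ℕ), f * (f * (e * (f * (e * f⁻¹) ^ (d.1.1 : ℕ))))] d.1.2
  have w0 : ∀ i k, w ((i, 0), k) = f ^ (k : ℕ) * (e * f⁻¹) ^ (i : ℕ) := fun _ _ => rfl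
  have w1 : ∀ i k, w ((i, 1), k) = f ^ (k : ℕ) * (f * (f * (e * (f * (e * f⁻¹) ^ (i : ℕ))))) :=
    fun _ _ => rfl
  refine exists_isCovering_of_words (w := w) ?_ ?_ x
  · rw [hee]
    have hedge : ∀ d, octahedron.edge d = octahedronEdge d := fun _ => rfl
    rintro ⟨⟨i, s⟩, k⟩
    obtain ⟨j, hj⟩ : ∃ j, i = 1 + j := ⟨i - 1, by abel⟩
    fin_cases s <;> fin_cases k <;>
      simp only [Fin.zero_eta, Fin.mk_one, Fin.reduceFinMk, Fin.isValue, hedge, octahedronEdge,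
        add_comm i 1, w0, w1, h00, h11, h22, hr1, one_mul, mul_assoc, hff, hee', h2]
    · simp [hj, hr1, hee']
    · subst hj
      rw [add_sub_cancel_left, hr1, ← h2, hee']
  · rw [hfe]
    exact fun d => by
      change f ^ ((d.2 + 1 : Fin 3) : ℕ) * _ = f * (f ^ (d.2 : ℕ) * _)
      rw [hp1, mul_assoc]
      rfl

theorem exists_icosahedron_covering (B : OrientedMap G) (hf : B.face ^ 3 = 1) (hr : B.rot ^ 5 = 1)
    (x : G) : ∃ φ, IsCovering icosahedron B φ := by
  have he := B.edge_mul_edge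
  rw [rot_eq_mul] at hr
  generalize hfe : B.face = f at *
  generalize hee : B.edge = e at *
  have hf' : f * f * f = 1 := by rw [← hf]; simp [pow_succ]
  have hff : ∀ y, f * (f * (f * y)) = y := fun y => by simp only [← mul_assoc, hf', one_mul]
  have hee' : ∀ y, e * (e * y) = y := fun y => by simp only [← mul_assoc, he, one_mul]
  have hinv : f⁻¹ = f * f := inv_eq_of_mul_eq_one_left hf'
  have h2 : ∀ y, f * (f * (e * (f * (f * (e * (f * y)))))) =
      e * (f * (e * (f * (e * (f * (f * y)))))) := fun y => by
    simpa only [mul_assoc, hinv] using congrArg (· * y) (mul_eq_of_rot_pow_five he hf' hr).symm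
  have h3 : ∀ y, e * (f * (f * (e * (f * (e * (f * (f * (e * (f * y))))))))) =
      f * (e * (f * (e * (f * (f * (e * (f * (e * (f * (f * y)))))))))) := fun y => by
    simpa only [mul_assoc, hinv] using congrArg (· * y) (mul_eq_of_rot_pow_five' he hf' hr)
  have hr1 : ∀ i : Fin 5, (e * f⁻¹) ^ ((1 + i : Fin 5) : ℕ) = e * (f * (f * (e * f⁻¹) ^ (i : ℕ))) :=
    fun i => by rw [perm_pow_val_add hr, hinv]; simp [mul_assoc]
  have hp1 : ∀ k : Fin 3, f ^ ((k + 1 : Fin 3) : ℕ) = f * f ^ (k : ℕ) := fun k => by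
    rw [add_comm, perm_pow_val_add hf]; rfl
  have h00 : f ^ ((0 : Fin 3) : ℕ) = 1 := rfl
  have h11 : f ^ ((1 : Fin 3) : ℕ) = f := pow_one f
  have h22 : f ^ ((2 : Fin 3) : ℕ) = f * f := pow_two f
  -- The four words descend from the triangle at `N` to the one at `S`. The remaining gluings need
  -- `h2` between the middle triangles of neighbouring sectors, and `h3` around `S`.
  let w : (Fin 5 × Fin 4) × Fin 3 → Equiv.Perm G := fun d => f ^ (d.2 : ℕ) *
    (![1, f * (e * f), e * (f * (f * (e * f))), f * (f * (e * (f * (e * (f * (f * (e * f)))))))]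
      d.1.2 * (e * f⁻¹) ^ (d.1.1 : ℕ))
  have w0 : ∀ i k, w ((i, 0), k) = f ^ (k : ℕ) * (1 * (e * f⁻¹) ^ (i : ℕ)) := fun _ _ => rfl
  have w1 : ∀ i k, w ((i, 1), k) = f ^ (k : ℕ) * (f * (e * f) * (e * f⁻¹) ^ (i : ℕ)) :=
    fun _ _ => rfl
  have w2 : ∀ i k, w ((i, 2), k) = f ^ (k : ℕ) * (e * (f * (f * (e * f))) * (e * f⁻¹) ^ (i : ℕ)) :=
    fun _ _ => rfl
  have w3 : ∀ i k, w ((i, 3), k) = f ^ (k : ℕ) *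
      (f * (f * (e * (f * (e * (f * (f * (e * f))))))) * (e * f⁻¹) ^ (i : ℕ)) := fun _ _ => rfl
  refine exists_isCovering_of_words (w := w) ?_ ?_ x
  · rw [hee]
    have hedge : ∀ d, icosahedron.edge d = icosahedronEdge d := fun _ => rfl
    rintro ⟨⟨i, s⟩, k⟩
    obtain ⟨j, hj⟩ : ∃ j, i = 1 + j := ⟨i - 1, by abel⟩
    fin_cases s <;> fin_cases k <;>
      simp only [Fin.zero_eta, Fin.mk_one, Fin.reduceFinMk, Fin.isValue, hedge, icosahedronEdge,
        add_comm i 1, w0, w1, w2, w3, h00, h11, h22, hr1, one_mul, mul_assoc, hff, hee']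
    · subst hj
      rw [add_sub_cancel_left, hr1, hee']
    · subst hj
      rw [add_sub_cancel_left, hr1, h2]
    · rw [h2, hee']
    · exact (h3 _).symm
    · subst hj
      rw [add_sub_cancel_left, hr1, ← h3, hee']
  · rw [hfe]
    exact fun d => by
      change f ^ ((d.2 + 1 : Fin 3) : ℕ) * _ = f * (f ^ (d.2 : ℕ) * _)
      rw [hp1, mul_assoc]
      rfl

end OrientedMap

/-! ### Subdivisions, connectedness and one-sheeted coverings -/

namespace OrientedMap

variable {G E : Type*}

theorem subdivide_edge_two (B : OrientedMap G) (g : G) :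
    B.subdivide.edge (g, 2) = (B.edge (B.face.symm g), 3) := rfl

theorem subdivide_edge_four (B : OrientedMap G) (g : G) :
    B.subdivide.edge (g, 4) = (B.face g, 0) := rfl

/-- An invariant set of darts of the subdivision is a union of tiles, and the tiles adjacent to that
of `g` determine those of `face g` and `edge g`. -/
theorem subdivide_connected_iff (B : OrientedMap G) : B.subdivide.Connected ↔ B.Connected := by
  rw [connected_iff, connected_iff]
  refine and_congr ⟨fun ⟨x⟩ => ⟨x.1⟩, fun ⟨x⟩ => ⟨(x, 0)⟩⟩ ⟨fun h s he hf ⟨x, hx⟩ d => ?_,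
    fun h s he hf ⟨x, hx⟩ d => ?_⟩
  · have hf' : ∀ d, B.face.symm d ∈ s ↔ d ∈ s := fun d => by
      rw [← hf, Equiv.apply_symm_apply]
    refine h {y | y.1 ∈ s} (fun y => ?_) (fun y => Iff.rfl) ⟨(x, 0), hx⟩ (d, 0)
    obtain ⟨g, k⟩ := y
    simp only [Set.mem_ofPred_eq]
    rcases fin_five_cases k with rfl | rfl | rfl | rfl | rfl
    · exact hf' g
    · exact (hf _).trans ((he _).trans (hf' g))
    · exact (he _).trans (hf' g)
    · exact (hf _).trans (he g)
    · exact hf g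
  · have h1 : ∀ g (k : Fin 5), (g, k + 1) ∈ s ↔ (g, k) ∈ s := fun g k => hf (g, k)
    have hk : ∀ g (k : Fin 5), (g, k) ∈ s ↔ (g, 0) ∈ s := by
      intro g k
      have a1 := h1 g 0
      have a2 := h1 g 1
      have a3 := h1 g 2
      have a4 := h1 g 3
      simp only [Fin.isValue, Fin.reduceAdd] at a1 a2 a3 a4
      rcases fin_five_cases k with rfl | rfl | rfl | rfl | rfl <;> tauto
    have hface : ∀ g, (B.face g, (0 : Fin 5)) ∈ s ↔ (g, 0) ∈ s := fun g => by
      rw [← subdivide_edge_four, he, hk]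
    have hedge : ∀ g, (B.edge g, (0 : Fin 5)) ∈ s ↔ (g, 0) ∈ s := fun g => by
      rw [← hk _ 3, ← hface g, ← hk _ 2, ← he (B.face g, 2), subdivide_edge_two,
        Equiv.symm_apply_apply]
    obtain ⟨d, k⟩ := d
    obtain ⟨x, l⟩ := x
    rw [hk]
    rw [hk] at hx
    exact h {g | (g, 0) ∈ s} hedge hface ⟨x, hx⟩ d

theorem IsCovering.surjective {C : OrientedMap E} {B : OrientedMap G} {φ : E → G}
    (h : IsCovering C B φ) (hB : B.Connected) [Nonempty E] : Surjective φ := by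
  obtain ⟨-, hs⟩ := (connected_iff B).1 hB
  have hf : ∀ d, φ (C.face.symm d) = B.face.symm (φ d) := fun d => by
    rw [Equiv.eq_symm_apply, ← h.2, Equiv.apply_symm_apply]
  refine hs (Set.range φ) (fun d => ⟨?_, ?_⟩) (fun d => ⟨?_, ?_⟩) (Set.range_nonempty φ)
  · rintro ⟨x, hx⟩
    exact ⟨C.edge x, by rw [h.1, hx, B.edge_edge]⟩
  · rintro ⟨x, rfl⟩
    exact ⟨C.edge x, h.1 x⟩
  · rintro ⟨x, hx⟩
    exact ⟨C.face.symm x, by rw [hf, hx, Equiv.symm_apply_apply]⟩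
  · rintro ⟨x, rfl⟩
    exact ⟨C.face x, h.2 x⟩

/-- A covering with one sheet gives the same subdivision. -/
theorem IsCovering.sameTiling_subdivide [Finite E] [Nonempty E] [Finite G] {C : OrientedMap E}
    {B : OrientedMap G} {φ : E → G} (h : IsCovering C B φ) (hB : B.Connected)
    (hcard : Nat.card G = Nat.card E) (s : G → Bool) :
    SameTiling B.subdivide (signLabel s) C.subdivide (signLabel (s ∘ φ)) := by
  have hbij : Bijective φ := (Nat.bijective_iff_surjective_and_card φ).2 ⟨h.surjective hB, hcard.symm⟩
  have hf : ∀ d, φ (C.face.symm d) = B.face.symm (φ d) := fun d => by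
    rw [Equiv.eq_symm_apply, ← h.2, Equiv.apply_symm_apply]
  refine SameTiling.symm ⟨Equiv.prodCongr (Equiv.ofBijective φ hbij) (Equiv.refl _), ?_,
    Or.inl ⟨fun _ => rfl, fun _ => rfl⟩⟩
  rintro ⟨g, k⟩
  rcases fin_five_cases k with rfl | rfl | rfl | rfl | rfl <;>
    simp [subdivide, subdivideEdge, h.1, h.2, hf]

theorem vertexOf_rot (M : OrientedMap E) (d : E) : M.vertexOf (M.rot d) = M.vertexOf d :=
  M.vertexOf_eq_iff.2 ⟨-1, by simp⟩

theorem minimalPeriod_eq_three {f : E → E} {d : E} (h : f (f (f d)) = d) (h' : f d ≠ d) :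
    minimalPeriod f d = 3 :=
  have : Fact (Nat.Prime 3) := ⟨Nat.prime_three⟩
  minimalPeriod_eq_prime h h'

end OrientedMap

/-- `{N α³βγ : N α²β, f γ³, v αⁿ}` -/
def degreeAVC (N f v n : ℕ) : AVC where
  numTiles := N
  tile := {Angle.α, Angle.α, Angle.α, Angle.β, Angle.γ}
  vertices := Multiset.replicate N {Angle.α, Angle.α, Angle.β} +
    Multiset.replicate f {Angle.γ, Angle.γ, Angle.γ} +
    Multiset.replicate v (Multiset.replicate n Angle.α)

theorem avc3C24_eq : avc3C24 = degreeAVC 24 8 6 4 := rfl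

theorem avc3C60_eq : avc3C60 = degreeAVC 60 20 12 5 := rfl

/-! ### Signs constant around each γ³ give tilings -/

namespace OrientedMap

variable {G : Type*} {B : OrientedMap G}

theorem HasTiles.face_pow {M : OrientedMap (G × Fin 5)} (hT : M.HasTiles) (k : ℕ) (g : G)
    (i : Fin 5) : (M.face ^ k) (g, i) = (g, i + Fin.ofNat 5 k) := by
  induction k with
  | zero => exact Prod.ext rfl (add_zero i).symm
  | succ k ih =>
    rw [pow_succ', Equiv.Perm.mul_apply, ih, hT, add_assoc]
    congr 2
    ext
    simp [Fin.val_add]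

/-- The invariant `u` tells centres, dividing points and old vertices apart, and names a dividing
point by the dart on which it comes first. The three darts so named in one tile are distinct. -/
theorem vertexOf_subdivide_injective (hf1 : ∀ g, B.face g ≠ g) (hr1 : ∀ g, B.rot g ≠ g) {g : G}
    {k l : Fin 5} (h : B.subdivide.vertexOf (g, k) = B.subdivide.vertexOf (g, l)) : k = l := by
  let u : G × Fin 5 → Fin 3 × Option G := fun x => ![(0, none), (1, some (B.face.symm x.1)),
    (1, some (B.edge (B.face.symm x.1))), (2, none), (1, some x.1)] x.2
  have hu : ∀ x, u (B.subdivide.rot x) = u x := by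
    rintro ⟨g, k⟩
    rcases fin_five_cases k with rfl | rfl | rfl | rfl | rfl
    · rfl
    · rfl
    · change (1, some (B.face.symm (B.face (B.edge (B.face.symm g))))) = u (g, 2)
      rw [Equiv.symm_apply_apply]
      rfl
    · rfl
    · change (1, some (B.edge (B.face.symm (B.face (B.edge g))))) = u (g, 4)
      rw [Equiv.symm_apply_apply, B.edge_edge]
      rfl
  have hu' : u (g, k) = u (g, l) :=
    sameCycle_apply_eq_of_invariant hu (B.subdivide.vertexOf_eq_iff.1 h)
  have h1 : B.face.symm g ≠ g := fun h => hf1 g (by rw [Equiv.symm_apply_eq] at h; exact h.symm)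
  have h2 : B.edge (B.face.symm g) ≠ g := hr1 g
  have h3 := B.edge_ne (B.face.symm g)
  rcases fin_five_cases k with rfl | rfl | rfl | rfl | rfl <;>
    rcases fin_five_cases l with rfl | rfl | rfl | rfl | rfl <;>
    simp [u, h1, h2, h3, h1.symm, h2.symm, h3.symm] at hu' ⊢

variable [Finite G]

/-- The sign patterns on a triangulation with vertices of degree `n` give tilings. -/
theorem isTilingFor_subdivide {s : G → Bool} {N f v n : ℕ} {pent : Fin 5 → Angle}
    (hpent : Finset.univ.val.map pent = {Angle.α, Angle.α, Angle.α, Angle.β, Angle.γ})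
    {j : Fin 5} {b : Bool} (hp : ∀ k, pent k = cornerLabel b (k - j)) (hc : B.Connected)
    (hf3 : ∀ g, B.face (B.face (B.face g)) = g) (hf1 : ∀ g, B.face g ≠ g)
    (hr1 : ∀ g, B.rot g ≠ g) (hr : ∀ g, minimalPeriod B.rot g = n)
    (hN : Nat.card G = N) (hNf : f * 3 = N) (hNv : v * n = N) (heuler : 2 * (f + v) = N + 4)
    (hs : ∀ g, s (B.face g) = s g) :
    IsTilingFor B.subdivide (signLabel s) pent (degreeAVC N f v n) := by
  classical
  have := Fintype.ofFinite G
  set M := B.subdivide with hMdef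
  have hT : M.HasTiles := fun _ _ => rfl
  have r0 : ∀ g, M.rot (g, 0) = (B.face g, 0) := fun g => rfl
  have r3 : ∀ g, M.rot (g, 3) = (B.rot g, 3) := fun g => rfl
  have r1 : ∀ g, M.rot (B.face g, 1) = (g, 4) := fun g => by
    change (B.face.symm (B.face g), (4 : Fin 5)) = _
    rw [Equiv.symm_apply_apply]
  have r4 : ∀ g, M.rot (g, 4) = (B.face (B.edge g), 2) := fun g => rfl
  have r2 : ∀ g, M.rot (B.face (B.edge g), 2) = (B.face g, 1) := fun g => by
    change (B.face (B.edge (B.face.symm (B.face (B.edge g)))), (1 : Fin 5)) = _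
    rw [Equiv.symm_apply_apply, B.edge_edge]
  have p0 : ∀ g, minimalPeriod M.rot (g, 0) = 3 := fun g =>
    minimalPeriod_eq_three (by simp only [r0, hf3]) (by simpa [r0] using hf1 g)
  have p1 : ∀ g, minimalPeriod M.rot (g, 1) = 3 := fun g => by
    obtain ⟨g, rfl⟩ := B.face.surjective g
    exact minimalPeriod_eq_three (by rw [r1, r4, r2]) (by simp [r1])
  have p2 : ∀ g, minimalPeriod M.rot (g, 2) = 3 := fun g => by
    obtain ⟨g, rfl⟩ := B.face.surjective g
    rw [← B.edge_edge g]
    exact minimalPeriod_eq_three (by rw [r2, r1, r4]) (by simp [r2])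
  have p4 : ∀ g, minimalPeriod M.rot (g, 4) = 3 := fun g =>
    minimalPeriod_eq_three (by rw [r4, r2, r1]) (by simp [r4])
  have p3 : ∀ g, minimalPeriod M.rot (g, 3) = n := fun g => by
    rw [← hr g]
    refine minimalPeriod_eq_minimalPeriod_iff.2 fun k => ?_
    have := perm_pow_conj (c := fun g => (g, (3 : Fin 5))) r3 k g
    simp only [Equiv.Perm.coe_pow] at this
    simp [IsPeriodicPt, IsFixedPt, this]
  have a0 : ∀ g, M.anglesAt (signLabel s) (M.vertexOf (g, 0)) =
      {Angle.γ, Angle.γ, Angle.γ} := fun g => by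
    rw [anglesAt_eq_of_card_eq_three]
    · simp [r0, signLabel, cornerLabel_eq_γ_iff.2]
    · rw [anglesAt_vertexOf, p0]; rfl
  have a4 : ∀ g, M.anglesAt (signLabel s) (M.vertexOf (g, 4)) =
      {Angle.α, Angle.α, Angle.β} := fun g => by
    rw [anglesAt_eq_of_card_eq_three]
    · rw [r4, r2]
      simp only [signLabel, hs]
      -- Position 2 is α; the positions 4 and 1 belong to tiles of equal sign, so exactly one of
      -- them is β.
      cases s g <;> cases s (B.edge g) <;> decide
    · rw [anglesAt_vertexOf, p4]; rfl
  have a1 : ∀ g, M.anglesAt (signLabel s) (M.vertexOf (g, 1)) =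
      {Angle.α, Angle.α, Angle.β} := fun g => by
    obtain ⟨g, rfl⟩ := B.face.surjective g
    rw [← vertexOf_rot, r1, a4]
  have a2 : ∀ g, M.anglesAt (signLabel s) (M.vertexOf (g, 2)) =
      {Angle.α, Angle.α, Angle.β} := fun g => by
    obtain ⟨g, rfl⟩ := B.face.surjective g
    rw [← B.edge_edge g, ← vertexOf_rot, r2, a1]
  have a3 : ∀ g, M.anglesAt (signLabel s) (M.vertexOf (g, 3)) =
      Multiset.replicate n Angle.α := fun g => by
    rw [anglesAt_vertexOf, p3]
    refine Multiset.eq_replicate.2 ⟨by simp, fun x hx => ?_⟩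
    obtain ⟨k, -, rfl⟩ := Multiset.mem_map.1 hx
    rw [perm_pow_conj (c := fun g => (g, (3 : Fin 5))) r3 k g]
    simp only [signLabel, cornerLabel]
    split_ifs <;> rfl
  obtain ⟨g₀⟩ := hc.1
  have hn : n ≠ 0 := hr g₀ ▸ (minimalPeriod_perm_pos B.rot g₀).ne'
  have hNn : (N : ℚ) * (n : ℚ)⁻¹ = v := by
    have : (n : ℚ) ≠ 0 := by exact_mod_cast hn
    field_simp
    rw [mul_comm]
    exact_mod_cast hNv.symm
  have hN3 : (N : ℚ) * 3⁻¹ = f := by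
    have : (N : ℚ) = f * 3 := by exact_mod_cast hNf.symm
    rw [this]; ring
  have hcardG : Fintype.card G = N := by rw [← hN, Nat.card_eq_fintype_card]
  -- The positions 1, 2, 4 together contribute `3 * N / 3` vertices, position 0 contributes `N / 3`,
  -- position 3 contributes `N / n`. Used with `P` trivial for Euler's formula and with `P` an
  -- equality for the AVC.
  have hcount : ∀ P : Multiset Angle → Prop,
      (Nat.card {x : M.Vertex // P (M.anglesAt (signLabel s) x)} : ℚ) =
        (if P {Angle.α, Angle.α, Angle.β} then (N : ℚ) else 0) +
        (if P {Angle.γ, Angle.γ, Angle.γ} then (f : ℚ) else 0) +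
        (if P (Multiset.replicate n Angle.α) then (v : ℚ) else 0) := by
    intro P
    have key := card_cycles_eq_sum M.rot fun x => P (M.anglesAt (signLabel s) x)
    refine key.trans ?_
    have hq : ∀ d, (Quotient.mk (Equiv.Perm.SameCycle.setoid M.rot) d) = M.vertexOf d :=
      fun _ => rfl
    rw [Fintype.sum_prod_type]
    simp only [Fin.sum_univ_five, hq, a0, a1, a2, a3, a4, p0, p1, p2, p3, p4, Finset.sum_const,
      Finset.card_univ, hcardG, nsmul_eq_mul]
    rw [← hNn, ← hN3]
    push_cast
    split_ifs <;> ring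
  have hpenta : M.Pentagonal := by
    refine ⟨fun ⟨g, k⟩ => ⟨?_, by simp [hT g k]⟩, ?_⟩
    · rw [hT.face_pow]
      exact Prod.ext rfl (add_zero k)
    rintro ⟨g, k⟩ d' hd' hv
    obtain ⟨i, rfl⟩ := hd'.exists_nat_pow_eq
    rw [hT.face_pow] at hv ⊢
    exact congrArg (Prod.mk g) (vertexOf_subdivide_injective hf1 hr1 hv)
  have hV : Nat.card M.Vertex = N + f + v := by
    have h := hcount fun _ => True
    simp only [if_true] at h
    rw [Nat.card_congr (Equiv.subtypeUnivEquiv fun _ => trivial)] at h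
    exact_mod_cast h
  have hD : Nat.card (G × Fin 5) = N * 5 := by rw [Nat.card_prod, hN, Nat.card_fin]
  have hF : Nat.card M.Face = N := by
    have := hpenta.card_face
    omega
  have hE := M.card_edge
  refine ⟨⟨(subdivide_connected_iff B).2 hc, by omega⟩, hpenta, ?_, hF, hpent, fun c => ?_⟩
  · intro d
    obtain ⟨g, i⟩ := d
    refine (congruent_iff hp _).2 ⟨-i, s g, fun k => ?_⟩
    rw [hT.face_pow, Fin.ofNat_val_eq_self, signLabel, sub_neg_eq_add, add_comm]
  · have h := hcount fun x => x = c
    simp only [degreeAVC, Multiset.count_add, Multiset.count_replicate]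
    exact_mod_cast h

end OrientedMap

/-! ### Changes of orientation as changes of sign -/

namespace OrientedMap

variable {G : Type*}

theorem signLabel_true_comp :
    reduction3C1 ∘ subdivideLabel = signLabel fun _ : G => true := by
  funext ⟨g, k⟩
  rcases fin_five_cases k with rfl | rfl | rfl | rfl | rfl <;> rfl

theorem signLabel_false_comp :
    reduction3C2 ∘ subdivideLabel = signLabel fun _ : G => false := by
  funext ⟨g, k⟩
  rcases fin_five_cases k with rfl | rfl | rfl | rfl | rfl <;> rfl

open Classical in
/-- Changing orientations changes the signs of the tiles. -/
theorem reorient_signLabel {M : OrientedMap (G × Fin 5)} (hT : M.HasTiles) (s : G → Bool)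
    (S : Set M.Vertex) :
    M.reorient (signLabel s) S =
      signLabel fun g => if M.vertexOf (g, 0) ∈ S then !s g else s g := by
  funext ⟨g, k⟩
  have hk : sInf {l : ℕ | signLabel s ((M.face ^ l) (g, k)) = Angle.γ} = ((-k : Fin 5) : ℕ) := by
    have : {l : ℕ | signLabel s ((M.face ^ l) (g, k)) = Angle.γ} =
        {l : ℕ | Fin.ofNat 5 l = -k} := by
      ext l
      simp only [Set.mem_ofPred_eq]
      rw [hT.face_pow, signLabel, cornerLabel_eq_γ_iff, add_eq_zero_iff_neg_eq, eq_comm]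
    rw [this]
    refine IsLeast.csInf_eq ⟨?_, fun l hl => ?_⟩
    · simp
    · rw [Set.mem_ofPred_eq] at hl
      rw [← hl]
      exact Nat.mod_le _ _
  have h1 : (M.face ^ ((-k : Fin 5) : ℕ)) (g, k) = (g, 0) := by
    rw [hT.face_pow, Fin.ofNat_val_eq_self, add_neg_cancel]
  have h2 : (M.face ^ (2 * ((-k : Fin 5) : ℕ))) (g, k) = (g, -k) := by
    rw [two_mul, pow_add, Equiv.Perm.mul_apply, h1, hT.face_pow, Fin.ofNat_val_eq_self, zero_add]
  simp only [reorient, hk, h1, h2]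
  simp only [signLabel, cornerLabel_neg]
  split_ifs <;> rfl

/-- The reductions of a pentagonal subdivision and their modifications are given by the signs of
the tiles of the original map. -/
theorem isModifiedReduction_subdivide_iff {D : Type*} {M : OrientedMap D} {label : D → Angle}
    {B : OrientedMap G} : IsModifiedReduction M label B.subdivide ↔
      ∃ s : G → Bool, (∀ g, s (B.face g) = s g) ∧
        SameTiling M label B.subdivide (signLabel s) := by
  classical
  have hT : B.subdivide.HasTiles := fun _ _ => rfl
  have hv : ∀ g, B.subdivide.vertexOf (B.face g, 0) = B.subdivide.vertexOf (g, 0) := fun g =>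
    vertexOf_rot B.subdivide (g, 0)
  constructor
  · rintro ⟨R, rfl | rfl, S, h⟩
    · rw [signLabel_true_comp, reorient_signLabel hT] at h
      exact ⟨_, fun g => by simp only [hv], h⟩
    · rw [signLabel_false_comp, reorient_signLabel hT] at h
      exact ⟨_, fun g => by simp only [hv], h⟩
  · rintro ⟨s, hs, h⟩
    -- `3C₁` has all signs true, so it suffices to flip at the γ³ with sign false; `3C₂` is the case
    -- where all are flipped.
    refine ⟨_, Or.inl rfl, {v | ∃ g, B.subdivide.vertexOf (g, 0) = v ∧ s g = false}, ?_⟩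
    rw [signLabel_true_comp, reorient_signLabel hT]
    convert h using 2
    funext g
    have key : (B.subdivide.vertexOf (g, 0) ∈
        {v | ∃ g, B.subdivide.vertexOf (g, 0) = v ∧ s g = false}) ↔ s g = false := by
      refine ⟨fun ⟨g', h', hg'⟩ => ?_, fun hg => ⟨g, rfl, hg⟩⟩
      have := sameCycle_apply_eq_of_invariant
        (u := fun x : G × Fin 5 => if x.2 = 0 then some (s x.1) else none) ?_
        (B.subdivide.vertexOf_eq_iff.1 h')
      · simpa [hg'] using this.symm
      · rintro ⟨g, k⟩
        rcases fin_five_cases k with rfl | rfl | rfl | rfl | rfl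
        · exact congrArg some (hs g)
        · rfl
        · rfl
        · rfl
        · rfl
    by_cases hg : s g = false
    · rw [if_pos (key.2 hg), hg]
      rfl
    · rw [if_neg (mt key.1 hg)]
      simpa using hg

end OrientedMap

/-! ### The classification for a general degree -/

theorem IsTilingFor.vertexCondition {D : Type*} [Finite D] {M : OrientedMap D} {label : D → Angle}
    {pent : Fin 5 → Angle} {N f v n : ℕ} (hM : IsTilingFor M label pent (degreeAVC N f v n)) :
    M.VertexCondition label n := by
  intro x
  have h := hM.vertices (M.anglesAt label x)
  have hpos : 0 < Nat.card {y : M.Vertex // M.anglesAt label y = M.anglesAt label x} := by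
    have : Finite M.Vertex := Quotient.finite _
    have : Nonempty {y : M.Vertex // M.anglesAt label y = M.anglesAt label x} := ⟨⟨x, rfl⟩⟩
    exact Nat.card_pos
  rw [h, Multiset.count_pos] at hpos
  simp only [degreeAVC, Multiset.mem_add] at hpos
  rcases hpos with (h | h) | h
  · exact Or.inl (Multiset.eq_of_mem_replicate h)
  · exact Or.inr (Or.inl (Multiset.eq_of_mem_replicate h))
  · exact Or.inr (Or.inr (Multiset.eq_of_mem_replicate h))

open OrientedMap in
/-- The tilings for an AVC of the form `degreeAVC`, when the triangulation `C` with the vertices of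
degree `n` covers every other one. -/
theorem isTilingFor_iff_isModifiedReduction.{u, v} {D : Type u} {E : Type v} [Finite D] [Finite E]
    {M : OrientedMap D} {label : D → Angle} {pent : Fin 5 → Angle} {C : OrientedMap E}
    {N f v n : ℕ}
    (hpent : Finset.univ.val.map pent = {Angle.α, Angle.α, Angle.α, Angle.β, Angle.γ})
    (hadj : AdjacentIn pent Angle.β Angle.γ) (hC : C.Connected)
    (hf3 : ∀ g, C.face (C.face (C.face g)) = g) (hf1 : ∀ g, C.face g ≠ g)
    (hr1 : ∀ g, C.rot g ≠ g) (hr : ∀ g, minimalPeriod C.rot g = n)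
    (hN : Nat.card E = N) (hNf : f * 3 = N) (hNv : v * n = N) (heuler : 2 * (f + v) = N + 4)
    (hcov : ∀ {G : Type u} (B : OrientedMap G), B.face ^ 3 = 1 → B.rot ^ n = 1 → ∀ _ : G,
      ∃ φ, IsCovering C B φ) :
    IsTilingFor M label pent (degreeAVC N f v n) ↔ IsModifiedReduction M label C.subdivide := by
  obtain ⟨j, b, hp⟩ := exists_eq_cornerLabel hpent hadj
  rw [isModifiedReduction_subdivide_iff]
  constructor
  · intro hM
    obtain ⟨M', s, hT, hsame⟩ := hM.exists_tiles hp
    have hM' := hsame.isTilingFor hM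
    obtain ⟨B, s', hB, hs', hB3, hBn⟩ := exists_sameTiling_subdivide hT
      (fun M'' s'' h => (h.isTilingFor hM').vertexCondition) hM'.spherical.1
    have hB' := hB.isTilingFor hM'
    have hBc := (subdivide_connected_iff B).1 hB'.spherical.1
    -- The tiles are the darts of `B`, so their number equals the number of darts of `C`, and the
    -- covering has one sheet.
    have hcard := hB'.pentagonal.card_face
    rw [hB'.numTiles, Nat.card_prod, Nat.card_fin] at hcard
    have hcard' : Nat.card {d // label d = Angle.γ} = Nat.card E := by
      rw [hN]
      exact (Nat.eq_of_mul_eq_mul_right (by norm_num) hcard).symm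
    obtain ⟨φ, hφ⟩ := hcov B hB3 hBn hBc.1.some
    have := hC.1
    exact ⟨s' ∘ φ, fun g => by simp only [comp_apply, hφ.2, hs'],
      (hsame.trans hB).trans (hφ.sameTiling_subdivide hBc hcard' s')⟩
  · rintro ⟨s, hs, h⟩
    exact h.symm.isTilingFor
      (isTilingFor_subdivide hpent hp hC hf3 hf1 hr1 hr hN hNf hNv heuler hs)

/-! ### Connectedness and vertex degrees of the two Platonic solids -/

namespace OrientedMap

theorem triangleFace_mem_iff {F : Type*} {s : Set (F × Fin 3)}
    (h : ∀ d, triangleFace F d ∈ s ↔ d ∈ s) (t : F) (k : Fin 3) : (t, k) ∈ s ↔ (t, 0) ∈ s := by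
  have h0 : (t, (1 : Fin 3)) ∈ s ↔ (t, 0) ∈ s := h (t, 0)
  have h1 : (t, (2 : Fin 3)) ∈ s ↔ (t, 1) ∈ s := h (t, 1)
  fin_cases k
  · rfl
  · exact h0
  · exact h1.trans h0

theorem iff_zero_of_iff_sub_one {n : ℕ} [NeZero n] {P : Fin n → Prop} (h : ∀ i, P (i - 1) ↔ P i)
    (i : Fin n) : P i ↔ P 0 := by
  obtain ⟨m, rfl⟩ : ∃ m : ℕ, Fin.ofNat n m = i := ⟨i, Fin.ofNat_val_eq_self i⟩
  induction m with
  | zero => rfl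
  | succ m ih =>
    rw [← ih, ← h]
    have : Fin.ofNat n (m + 1) = Fin.ofNat n m + 1 := by ext; simp [Fin.val_add]
    rw [this, add_sub_cancel_right]

theorem octahedron_connected : octahedron.Connected := by
  refine (connected_iff _).2 ⟨⟨((0, 0), 0)⟩, fun s he hf ⟨x, hx⟩ d => ?_⟩
  have hk := triangleFace_mem_iff hf
  have e0 : ∀ i, ((i - 1, 0), 0) ∈ s ↔ ((i, 0), 0) ∈ s := fun i =>
    (hk _ 2).symm.trans (he ((i, 0), 0))
  have e1 : ∀ i, ((i, 1), 0) ∈ s ↔ ((i, 0), 0) ∈ s := fun i =>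
    (hk _ 1).symm.trans ((he ((i, 0), 1)).trans (hk _ 1))
  have e2 := iff_zero_of_iff_sub_one (P := fun i => ((i, 0), 0) ∈ s) e0
  have key : ∀ d, d ∈ s ↔ ((0, 0), 0) ∈ s := by
    rintro ⟨⟨i, j⟩, k⟩
    rw [hk]
    fin_cases j
    · exact e2 i
    · exact (e1 i).trans (e2 i)
  exact (key d).2 ((key x).1 hx)

theorem icosahedron_connected : icosahedron.Connected := by
  refine (connected_iff _).2 ⟨⟨((0, 0), 0)⟩, fun s he hf ⟨x, hx⟩ d => ?_⟩
  have hk := triangleFace_mem_iff hf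
  have e0 : ∀ i, ((i - 1, 0), 0) ∈ s ↔ ((i, 0), 0) ∈ s := fun i =>
    (hk _ 2).symm.trans (he ((i, 0), 0))
  have e1 : ∀ i, ((i, 1), 0) ∈ s ↔ ((i, 0), 0) ∈ s := fun i =>
    (hk _ 2).symm.trans ((he ((i, 0), 1)).trans (hk _ 1))
  have e2 : ∀ i, ((i, 2), 0) ∈ s ↔ ((i, 1), 0) ∈ s := fun i =>
    (he ((i, 1), 1)).trans (hk _ 1)
  have e3 : ∀ i, ((i, 3), 0) ∈ s ↔ ((i, 2), 0) ∈ s := fun i =>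
    (hk _ 1).symm.trans ((he ((i, 2), 1)).trans (hk _ 1))
  have e4 := iff_zero_of_iff_sub_one (P := fun i => ((i, 0), 0) ∈ s) e0
  have key : ∀ d, d ∈ s ↔ ((0, 0), 0) ∈ s := by
    rintro ⟨⟨i, j⟩, k⟩
    rw [hk]
    fin_cases j
    · exact e4 i
    · exact (e1 i).trans (e4 i)
    · exact (e2 i).trans ((e1 i).trans (e4 i))
    · exact (e3 i).trans ((e2 i).trans ((e1 i).trans (e4 i)))
  exact (key d).2 ((key x).1 hx)

theorem minimalPeriod_octahedron_rot (d) : minimalPeriod octahedron.rot d = 4 := by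
  -- The period is `2 ^ (1 + 1)`: the second power of `rot` fixes no dart, the fourth fixes all.
  refine minimalPeriod_eq_prime_pow (p := 2) (k := 1) ?_ ?_
  · revert d; unfold IsPeriodicPt IsFixedPt; decide
  · revert d; unfold IsPeriodicPt IsFixedPt; decide

theorem minimalPeriod_icosahedron_rot (d) : minimalPeriod icosahedron.rot d = 5 := by
  have : Fact (Nat.Prime 5) := ⟨Nat.prime_five⟩
  refine minimalPeriod_eq_prime ?_ ?_
  · revert d; unfold IsPeriodicPt IsFixedPt; decide
  · revert d; unfold IsFixedPt; decide

end OrientedMap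

open OrientedMap in
theorem theorem9 {D : Type*} [Finite D] (M : OrientedMap D) (label : D → Angle)
    (pent : Fin 5 → Angle)
    (hpent : Finset.univ.val.map pent = {Angle.α, Angle.α, Angle.α, Angle.β, Angle.γ})
    (hadj : AdjacentIn pent Angle.β Angle.γ) :
    (IsTilingFor M label pent avc3C24 ↔ IsModifiedReduction M label OrientedMap.PP8) ∧
    (IsTilingFor M label pent avc3C60 ↔ IsModifiedReduction M label OrientedMap.PP20) := by
  rw [avc3C24_eq, avc3C60_eq]
  constructor
  · exact isTilingFor_iff_isModifiedReduction hpent hadj octahedron_connected (by decide)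
      (by decide) (by decide) minimalPeriod_octahedron_rot (by simp) rfl rfl rfl
      fun B h1 h2 x => exists_octahedron_covering B h1 h2 x
  · exact isTilingFor_iff_isModifiedReduction hpent hadj icosahedron_connected (by decide)
      (by decide) (by decide) minimalPeriod_icosahedron_rot (by simp) rfl rfl rfl
      fun B h1 h2 x => exists_icosahedron_covering B h1 h2 x
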